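/- **Theorem (extended Morse theorem).** Let $K$ be a finite abstract simplicial complex (a finite family of non-empty finite sets, the simplices, closed under passing to non-empty subsets) and let $k\in\mathbb N$. A *facet* of a simplex $\beta$ is a face $\sigma\subset\beta$ with $|\beta|=|\sigma|+1$; then $\beta$ is a *cofacet* of $\sigma$. On $\mathbb R^k$ write $x\preceq y$ if $x_i\le y_i$ for all $i$, and $x\precneqq y$ if $x\preceq y$ and $x\ne y$. For $f:K\to\mathbb R^k$ put $$H_f(\sigma)=\{\beta \text{ cofacet of }\sigma : f(\beta)\preceq f(\sigma)\},\qquad T_f(\sigma)=\{\alpha\text{ facet of }\sigma : f(\alpha)\succeq f(\sigma)\}.$$ Let $f:K\to\mathbb R^k$ be a *multidimensional discrete Morse function*: for every $\sigma\in K$, $|H_f(\sigma)|\le 1$, $|T_f(\sigma)|\le 1$, $f(\sigma)\precneqq f(\beta)$ for every cofacet $\beta\notin H_f(\sigma)$, and $f(\alpha)\precneqq f(\sigma)$ for every facet $\alpha\notin T_f(\sigma)$. A simplex $\sigma$ is *critical* if $H_f(\sigma)=T_f(\sigma)=\emptyset$. The *gradient* of $f$ is the partial map $\mathcal V$ on $K$,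 defined where $T_f(\sigma)=\emptyset$, with $\mathcal V(\sigma)=\sigma$ if $H_f(\sigma)=\emptyset$ and $\mathcal V(\sigma)=\beta$ if $H_f(\sigma)=\{\beta\}$. For $S\subseteq K$ let $\operatorname{Cl}S$ be the set of all faces of simplices of $S$, $\operatorname{Ex}S=\operatorname{Cl}S\setminus S$ its exit set, and $|S|$ the union of the open simplices belonging to $S$ in the geometric realization of $K$. The *gradient flow* $\Pi_f$ assigns to $\sigma$ the set $\operatorname{Cl}\{\sigma\}$ if $\mathcal V(\sigma)=\sigma$, the set $\operatorname{Ex}\{\sigma\}\setminus\{\alpha\}$ if $\sigma=\mathcal V(\alpha)$ with $\alpha\neq\sigma$, and $\{\mathcal V(\sigma)\}$ if $\mathcal V(\sigma)$ is defined and different from $\sigma$. Write $\sigma\to_f\tau$ if there are $n\ge1$ and $\sigma=\rho_0,\dots,\rho_n=\tau$ with $\rho_{i+1}\in\Pi_f(\rho_i)$ for all $i<n$. For a set $I$ of critical simplices the *Morse set* is $$M(I)=\{\sigma\in K : \tau'\to_f\sigma\to_f\tau\text{ for some }\tau,\tau'\in I\}.$$ For $a\in\mathbb R^k$ let $K(a)=\operatorname{Cl}\{\sigma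 : f(\sigma)\preceq a\}$. Let $a\precneqq b$ in $\mathbb R^k$, let $Q_a^b=\{c\in\mathbb R^k : c\preceq b \text{ and } c_i>a_i\text{ for some }i\}$, and let $$I=\{\sigma \text{ critical} : f(\sigma)\in Q_a^b\},\qquad A=\{\sigma\in K(b)\setminus K(a) : \sigma\not\to_f\tau\text{ for all }\tau\in I\}.$$ Then: 1. $K(a)\subseteq K(a)\cup A\subseteq K(a)\cup A\cup M(I)\subseteq K(b)$ are subcomplexes of $K$, $M(I)$ is disjoint from $K(a)\cup A$, and, by sequences of elementary simplicial collapses, $K(a)\cup A\searrow K(a)$ and $K(b)\searrow K(a)\cup A\cup M(I)$. If $I=\emptyset$, then $K(b)\searrow K(a)$; if $I=\{\sigma\}$, then $M(I)=\{\sigma\}$. 2. $K(b)$ is homotopy equivalent to $K(a)$ with $M(I)$ attached along its exit set, $$K(b)\simeq K(a)\bigcup_{\operatorname{Ex}M(I)}M(I),$$ in the following sense. One has $\operatorname{Ex}M(I)\subseteq K(a)\cup A$. There is a continuous map $\varphi:|\operatorname{Ex}M(I)|\to|K(a)|$ which, as a map into $|K(a)\cup A|$, is homotopic to the inclusion; it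 is unique up to homotopy. For every such $\varphi$, $|K(b)|$ is homotopy equivalent to the adjunction space $|K(a)|\cup_\varphi|\operatorname{Cl}M(I)|$, that is, the quotient of the disjoint union $|K(a)|\sqcup|\operatorname{Cl}M(I)|$ by the identifications $x\sim\varphi(x)$, $x\in|\operatorname{Ex}M(I)|$. -/

import Mathlib

open scoped ContinuousMap

namespace MDM

/-! Simplicial complexes are `PreAbstractSimplicialComplex`es with finitely many faces; `↥K` is the
type of simplices of `K`, and sets of simplices are terms of `Set K`. -/

section Combinatorics

variable {ι : Type*} {K : PreAbstractSimplicialComplex ι}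

/-- `IsFacet σ β`: `σ` is a facet of `β`, equivalently `β` is a cofacet of `σ`. -/
def IsFacet (σ β : K) : Prop :=
  σ.1 ⊆ β.1 ∧ β.1.card = σ.1.card + 1

/-- `Cl S`: all faces of all simplices of `S`. -/
def Cl (S : Set K) : Set K :=
  {τ | ∃ σ ∈ S, τ.1 ⊆ σ.1}

/-- The exit set `Ex S = Cl S \ S`. -/
def Ex (S : Set K) : Set K :=
  Cl S \ S

/-- A set of simplices is a subcomplex if it contains all faces of its elements. -/
def IsSubcomplex (S : Set K) : Prop :=
  ∀ σ ∈ S, ∀ τ : K, τ.1 ⊆ σ.1 → τ ∈ S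

/-- An elementary collapse of the subcomplex `S`: remove a free face `σ` of `S` together with its
unique cofacet `τ` in `S`. -/
def ElementaryCollapse (S S' : Set K) : Prop :=
  IsSubcomplex S ∧ ∃ σ ∈ S, ∃ τ ∈ S, IsFacet σ τ ∧ (∀ β ∈ S, IsFacet σ β → β = τ) ∧
    S' = S \ {σ, τ}

/-- `S` collapses onto `S'`: a finite (possibly empty) sequence of elementary collapses. -/
def Collapses (S S' : Set K) : Prop :=
  Relation.ReflTransGen ElementaryCollapse S S'

variable {k : ℕ}

/-- `H f σ`: cofacets `β` of `σ` with `f β ⪯ f σ` (componentwise order on `ℝ^k`). -/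
def H (f : K → Fin k → ℝ) (σ : K) : Set K :=
  {β | IsFacet σ β ∧ f β ≤ f σ}

/-- `T f σ`: facets `α` of `σ` with `f α ⪰ f σ`. -/
def T (f : K → Fin k → ℝ) (σ : K) : Set K :=
  {α | IsFacet α σ ∧ f σ ≤ f α}

/-- Multidimensional discrete Morse functions. On `Fin k → ℝ`, `x < y` means `x ≤ y`
componentwise and `x ≠ y`. -/
structure IsMDM (f : K → Fin k → ℝ) : Prop where
  card_H : ∀ σ, (H f σ).encard ≤ 1
  card_T : ∀ σ, (T f σ).encard ≤ 1
  cofacet_lt : ∀ σ β, IsFacet σ β → β ∉ H f σ → f σ < f β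
  facet_lt : ∀ σ α, IsFacet α σ → α ∉ T f σ → f α < f σ

/-- Critical simplices. -/
def IsCritical (f : K → Fin k → ℝ) (σ : K) : Prop :=
  H f σ = ∅ ∧ T f σ = ∅

/-- The graph of the gradient vector field `V` of `f`, a partial map `K ⇀ K`: `Gradient f σ β`
says that `V σ` is defined and equal to `β`. -/
def Gradient (f : K → Fin k → ℝ) (σ β : K) : Prop :=
  T f σ = ∅ ∧ ((H f σ = ∅ ∧ β = σ) ∨ H f σ = {β})

/-- The flow of a partial self-map of `K` with graph `V`:
`Cl σ` for a fixed point `σ` of `V`, `Ex σ \ {V⁻¹ σ}` for `σ` in the image but not fixed, and `{V σ}`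
for `σ` in the domain but not fixed. -/
def flow (V : K → K → Prop) (σ : K) : Set K :=
  {τ | (V σ σ ∧ τ ∈ Cl {σ}) ∨
    (∃ α, α ≠ σ ∧ V α σ ∧ τ ∈ Ex {σ} \ {α}) ∨
    (V σ τ ∧ τ ≠ σ)}

/-- `Connects f σ τ`: there is a nontrivial solution (finite sequence of at least one step) of the
gradient flow of `f` going from `σ` to `τ`. -/
def Connects (f : K → Fin k → ℝ) : K → K → Prop :=
  Relation.TransGen fun σ τ => τ ∈ flow (Gradient f) σ

/-- The connecting set `C(τ', τ)` of two critical simplices. -/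
def connectingSet (f : K → Fin k → ℝ) (τ' τ : K) : Set K :=
  {σ | Connects f τ' σ ∧ Connects f σ τ}

/-- The Morse set `M(I)` of a set `I` of critical simplices. -/
def morseSet (f : K → Fin k → ℝ) (I : Set K) : Set K :=
  ⋃ τ ∈ I, ⋃ τ' ∈ I, connectingSet f τ' τ

/-- The sublevel complex `K(a)`: the smallest subcomplex containing all `σ` with `f σ ⪯ a`. -/
def sublevel (f : K → Fin k → ℝ) (a : Fin k → ℝ) : Set K :=
  Cl {σ | f σ ≤ a}

/-- The region `Q_a^b` of `ℝ^k`. -/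
def Q (a b : Fin k → ℝ) : Set (Fin k → ℝ) :=
  {c | c ≤ b ∧ ∃ i, a i < c i}

/-- The critical simplices with value in `Q_a^b`. -/
def criticalIn (f : K → Fin k → ℝ) (a b : Fin k → ℝ) : Set K :=
  {σ | IsCritical f σ ∧ f σ ∈ Q a b}

/-- The simplices of `K(b) \ K(a)` that are not connected to any simplex of `I`. -/
def unconnected (f : K → Fin k → ℝ) (a b : Fin k → ℝ) (I : Set K) : Set K :=
  {σ | σ ∈ sublevel f b \ sublevel f a ∧ ∀ τ ∈ I, ¬ Connects f σ τ}

end Combinatorics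

section Topology

variable {ι : Type*} {K : PreAbstractSimplicialComplex ι}

/-- The geometric realization of a set of simplices, in barycentric coordinates: the union of the
open simplices belonging to `S`, inside `ι → ℝ`. For a subcomplex (of a finite complex) this is its
usual polyhedron, with the usual topology. -/
def realization (S : Set K) : Set (ι → ℝ) :=
  {x | ∃ σ ∈ S, (∀ v ∈ σ.1, 0 < x v) ∧ (∀ v ∉ σ.1, x v = 0) ∧ ∑ v ∈ σ.1, x v = 1}

theorem realization_mono {S S' : Set K} (h : S ⊆ S') : realization S ⊆ realization S' :=
  fun _ ⟨σ, hσ, hx⟩ => ⟨σ, h hσ, hx⟩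

/-- The inclusion of realizations. -/
def incl {S S' : Set K} (h : S ⊆ S') : C(realization S, realization S') where
  toFun := Set.inclusion (realization_mono h)
  continuous_toFun := continuous_inclusion (realization_mono h)

/-- The relation generating the gluing of `X` to `Y` along `i : E → X` and `φ : E → Y`. -/
inductive AttachRel {E X Y : Type*} (i : E → X) (φ : E → Y) : X ⊕ Y → X ⊕ Y → Prop
  | glue (e : E) : AttachRel i φ (Sum.inl (i e)) (Sum.inr (φ e))

/-- The adjunction space `Y ∪_φ X`: the quotient of `X ⊕ Y` identifying `i e` with `φ e` for all
`e : E`, with the quotient topology. -/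
def Attach {E X Y : Type*} (i : E → X) (φ : E → Y) : Type _ :=
  Quot (AttachRel i φ)

instance {E X Y : Type*} [TopologicalSpace X] [TopologicalSpace Y] (i : E → X) (φ : E → Y) :
    TopologicalSpace (Attach i φ) :=
  inferInstanceAs (TopologicalSpace (Quot (AttachRel i φ)))

theorem ex_subset_cl (S : Set K) : Ex S ⊆ Cl S :=
  Set.sdiff_subset

/-- `AttachAlongExit φ` is the space `|L| ∪_φ |Cl M|` obtained from `|L|` by attaching the
(closure of the) set of simplices `M` along its exit set by means of `φ : |Ex M| → |L|`. -/
abbrev AttachAlongExit {M L : Set K} (φ : C(realization (Ex M), realization L)) : Type _ :=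
  Attach (incl (ex_subset_cl M)) φ

end Topology

end MDM

/-! The idea is to replace `f` by a scalar-like potential `value`, equal to `f` of the gradient
target when there is one and to `f` otherwise. It is monotone under inclusion of faces, constant on
gradient pairs and strict on every other proper inclusion (`value_lt_of_ssubset`). Hence `K(a)` is
exactly the set where `value ≤ a`, the flow never increases `value`, and a critical simplex cannot
be left and revisited.

A gradient pair of maximal `value` in a difference of pair-closed complexes without critical
simplices has a free face as its source, so the pair can be collapsed (`IsMDM.collapses`). `K(a) ∪
A` is the part of `K(b)` from which the flow never reaches `I`; adding `M(I)` adds the part lying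
between simplices of `I`. Both unions are closed under the flow and under pairing, hence are
subcomplexes, and all critical simplices of `K(b) \ K(a)` lie in `M(I)`.

For the topology, collapses are strong deformation retractions. `|K(a) ∪ A ∪ M|` is an adjunction
space over `|K(a) ∪ A|`, and its homotopy type survives a homotopy of the attaching map (through an
explicit retraction of the cylinder) and a deformation retraction of the base. -/

namespace MDM

/-! ### The potential attached to a Morse function, and collapsing of gradient pairs. -/

section Value

variable {ι : Type*} {K : PreAbstractSimplicialComplex ι} {k : ℕ} {f : K → Fin k → ℝ}

theorem face_mem {σ : K} {t : Finset ι} (h : t ⊆ σ.1) (ht : t.Nonempty) : t ∈ K :=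
  (K.isRelLowerSet_faces σ.2).2 h ht

theorem face_nonempty (σ : K) : σ.1.Nonempty := (K.isRelLowerSet_faces σ.2).1

theorem IsFacet.ne {σ τ : K} (h : IsFacet σ τ) : σ ≠ τ := by
  rintro rfl
  have := h.2
  omega

/-- Between a simplex and a face of codimension two there is a second intermediate face. -/
theorem exists_other_facet {α σ β : K} (h₁ : IsFacet α σ) (h₂ : IsFacet σ β) :
    ∃ σ' : K, IsFacet α σ' ∧ IsFacet σ' β ∧ σ' ≠ σ := by
  classical
  obtain ⟨u, hu, huσ⟩ : ∃ u ∈ β.1, u ∉ σ.1 := by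
    by_contra! h
    have := Finset.card_le_card h
    have := h₂.2
    omega
  have huα : u ∉ α.1 := fun h => huσ (h₁.1 h)
  have hsub : insert u α.1 ⊆ β.1 := Finset.insert_subset hu (h₁.1.trans h₂.1)
  refine ⟨⟨insert u α.1, face_mem hsub (Finset.insert_nonempty _ _)⟩,
    ⟨Finset.subset_insert _ _, Finset.card_insert_of_notMem huα⟩, ⟨hsub, ?_⟩, ?_⟩
  · rw [h₂.2, h₁.2, Finset.card_insert_of_notMem huα]
  · intro h
    apply huσ
    rw [← h]
    exact Finset.mem_insert_self _ _

theorem IsMDM.eq_of_mem_H (hf : IsMDM f) {σ β β' : K} (h : β ∈ H f σ) (h' : β' ∈ H f σ) :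
    β = β' :=
  Set.encard_le_one_iff.1 (hf.card_H σ) _ _ h h'

theorem IsMDM.eq_of_mem_T (hf : IsMDM f) {σ β β' : K} (h : β ∈ T f σ) (h' : β' ∈ T f σ) :
    β = β' :=
  Set.encard_le_one_iff.1 (hf.card_T σ) _ _ h h'

/-- No simplex is both the source and the target of the gradient. -/
theorem IsMDM.not_mem_H_of_mem_T (hf : IsMDM f) {α σ β : K} (hα : α ∈ T f σ) : β ∉ H f σ := by
  intro hβ
  -- The exceptional cofacet of `α` and the exceptional facet of `β` are both `σ`, so the route
  -- through `σ'` is strict: `f α < f σ' < f β ≤ f σ ≤ f α`.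
  obtain ⟨σ', h₁, h₂, hne⟩ := exists_other_facet hα.1 hβ.1
  have h₃ : f α < f σ' := hf.cofacet_lt _ _ h₁ fun h => hne (hf.eq_of_mem_H h hα)
  have h₄ : f σ' < f β := hf.facet_lt _ _ h₂ fun h => hne (hf.eq_of_mem_T h hβ)
  exact absurd ((h₃.trans h₄).trans_le (hβ.2.trans hα.2)) (lt_irrefl _)

open Classical in
/-- The value of the target of the gradient at `σ` if there is one, and the value of `σ`
otherwise. -/
noncomputable def value (f : K → Fin k → ℝ) (σ : K) : Fin k → ℝ :=
  if h : (H f σ).Nonempty then f h.some else f σ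

theorem IsMDM.value_of_mem_H (hf : IsMDM f) {σ β : K} (h : β ∈ H f σ) : value f σ = f β := by
  have hne : (H f σ).Nonempty := ⟨β, h⟩
  rw [value, dif_pos hne, hf.eq_of_mem_H hne.some_mem h]

theorem value_of_H_eq_empty {σ : K} (h : H f σ = ∅) : value f σ = f σ := by
  rw [value, dif_neg (by simp [h])]

theorem IsMDM.H_eq_empty_of_mem_T (hf : IsMDM f) {α σ : K} (h : α ∈ T f σ) : H f σ = ∅ :=
  Set.eq_empty_of_forall_notMem fun _ => hf.not_mem_H_of_mem_T h

theorem IsMDM.T_eq_empty_of_mem_H (hf : IsMDM f) {σ β : K} (h : β ∈ H f σ) : T f σ = ∅ :=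
  Set.eq_empty_of_forall_notMem fun _ h' => hf.not_mem_H_of_mem_T h' h

theorem IsMDM.value_eq_of_mem_H (hf : IsMDM f) {σ β : K} (h : β ∈ H f σ) :
    value f σ = value f β := by
  rw [hf.value_of_mem_H h, value_of_H_eq_empty (hf.H_eq_empty_of_mem_T h)]

theorem IsMDM.value_le (hf : IsMDM f) (σ : K) : value f σ ≤ f σ := by
  rcases (H f σ).eq_empty_or_nonempty with h | ⟨β, h⟩
  · exact (value_of_H_eq_empty h).le
  · exact (hf.value_of_mem_H h).trans_le h.2

/-- If `σ` is paired with `β`, then `f τ < f σ` is not enough, since `f β ≤ f σ`. The other face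
`σ'` between `τ` and `β` has `f σ' < f β`, and `value f τ ≤ f σ'` whether or not `τ` is paired with
`σ'`. -/
theorem IsMDM.value_lt_of_isFacet (hf : IsMDM f) {τ σ : K} (h : IsFacet τ σ) (hτ : σ ∉ H f τ) :
    value f τ < value f σ := by
  rcases (H f σ).eq_empty_or_nonempty with hσ | ⟨β, hβ⟩
  · rw [value_of_H_eq_empty hσ]
    exact (hf.value_le τ).trans_lt (hf.facet_lt _ _ h hτ)
  · rw [hf.value_of_mem_H hβ]
    obtain ⟨σ', h₁, h₂, hne⟩ := exists_other_facet h hβ.1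
    have h₄ : f σ' < f β := hf.facet_lt _ _ h₂ fun h => hne (hf.eq_of_mem_T h hβ)
    by_cases h' : σ' ∈ H f τ
    · rwa [hf.value_of_mem_H h']
    · exact ((hf.value_le τ).trans_lt (hf.facet_lt _ _ h₁ h')).trans h₄

/-- A chain of facets from `τ` to `σ` can be flat only along gradient pairs, and two consecutive
steps cannot both be pairs because a target is never a source. -/
theorem IsMDM.value_lt_of_ssubset (hf : IsMDM f) {τ σ : K} (h : τ.1 ⊂ σ.1) (hτ : σ ∉ H f τ) :
    value f τ < value f σ := by
  classical
  induction hn : σ.1.card using Nat.strong_induction_on generalizing σ with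
  | _ n ih =>
    obtain ⟨u, huσ, huτ⟩ := Finset.exists_of_ssubset h
    have hsub : τ.1 ⊆ σ.1.erase u := fun x hx =>
      Finset.mem_erase.2 ⟨fun h' => huτ (h' ▸ hx), h.1 hx⟩
    let ρ : K := ⟨σ.1.erase u, face_mem (Finset.erase_subset _ _) ((face_nonempty τ).mono hsub)⟩
    have hρ : IsFacet ρ σ :=
      ⟨Finset.erase_subset _ _, (Finset.card_erase_add_one huσ).symm⟩
    by_cases hτρ : τ = ρ
    · exact hf.value_lt_of_isFacet (hτρ ▸ hρ) hτ
    have hss : τ.1 ⊂ ρ.1 :=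
      Finset.ssubset_iff_subset_ne.2 ⟨hsub, fun h' => hτρ (Subtype.ext h')⟩
    by_cases h₁ : ρ ∈ H f τ
    · rw [hf.value_eq_of_mem_H h₁]
      exact hf.value_lt_of_isFacet hρ (hf.not_mem_H_of_mem_T h₁)
    · have h₂ := ih _ (by have := hρ.2; omega) hss h₁ rfl
      by_cases h₃ : σ ∈ H f ρ
      · rwa [← hf.value_eq_of_mem_H h₃]
      · exact h₂.trans (hf.value_lt_of_isFacet hρ h₃)

theorem IsMDM.value_mono (hf : IsMDM f) {τ σ : K} (h : τ.1 ⊆ σ.1) : value f τ ≤ value f σ := by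
  by_cases hne : τ = σ
  · rw [hne]
  by_cases hτ : σ ∈ H f τ
  · exact (hf.value_eq_of_mem_H hτ).le
  · exact (hf.value_lt_of_ssubset
      (Finset.ssubset_iff_subset_ne.2 ⟨h, fun h' => hne (Subtype.ext h')⟩) hτ).le

/-- Taking the closure only adds sources whose targets have value at most `a`; the potential already
accounts for them. -/
theorem IsMDM.mem_sublevel_iff (hf : IsMDM f) {a : Fin k → ℝ} {σ : K} :
    σ ∈ sublevel f a ↔ value f σ ≤ a := by
  constructor
  · rintro ⟨ρ, hρ, h⟩
    exact (hf.value_mono h).trans ((hf.value_le ρ).trans hρ)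
  · intro h
    rcases (H f σ).eq_empty_or_nonempty with hσ | ⟨β, hβ⟩
    · exact ⟨σ, by rwa [Set.mem_ofPred_eq, ← value_of_H_eq_empty hσ], subset_rfl⟩
    · exact ⟨β, by rwa [Set.mem_ofPred_eq, ← hf.value_of_mem_H hβ], hβ.1.1⟩

theorem isSubcomplex_sublevel (a : Fin k → ℝ) : IsSubcomplex (sublevel f a) :=
  fun _ ⟨ρ, hρ, h⟩ _ hτ => ⟨ρ, hρ, hτ.trans h⟩

/-- A set of simplices is closed under pairing if it contains either both or none of `σ` and its
image under the gradient. -/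
def PairClosed (f : K → Fin k → ℝ) (S : Set K) : Prop :=
  ∀ σ β, β ∈ H f σ → (σ ∈ S ↔ β ∈ S)

theorem IsMDM.pairClosed_sublevel (hf : IsMDM f) (a : Fin k → ℝ) :
    PairClosed f (sublevel f a) := fun σ β h => by
  rw [hf.mem_sublevel_iff, hf.mem_sublevel_iff, hf.value_eq_of_mem_H h]

theorem PairClosed.union {S S' : Set K} (h : PairClosed f S) (h' : PairClosed f S') :
    PairClosed f (S ∪ S') := fun σ β hβ => or_congr (h σ β hβ) (h' σ β hβ)

theorem exists_pair_of_not_isCritical {σ : K} (h : ¬ IsCritical f σ) :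
    ∃ α β, β ∈ H f α ∧ (σ = α ∨ σ = β) := by
  rw [IsCritical, not_and_or] at h
  rcases h with h | h
  · obtain ⟨β, hβ⟩ := Set.nonempty_iff_ne_empty.2 h
    exact ⟨σ, β, hβ, .inl rfl⟩
  · obtain ⟨α, hα⟩ := Set.nonempty_iff_ne_empty.2 h
    exact ⟨α, σ, hα, .inr rfl⟩

/-- A complex collapses onto a subcomplex if the gradient pairs off the remaining simplices. -/
theorem IsMDM.collapses [Finite K] (hf : IsMDM f) {X Y : Set K} (hX : IsSubcomplex X)
    (hY : IsSubcomplex Y) (hYX : Y ⊆ X) (hXp : PairClosed f X) (hYp : PairClosed f Y)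
    (hc : ∀ σ ∈ X \ Y, ¬ IsCritical f σ) : Collapses X Y := by
  induction hn : X.ncard using Nat.strong_induction_on generalizing X with
  | _ n ih =>
    rcases (X \ Y).eq_empty_or_nonempty with he | hne
    · rw [Set.Subset.antisymm (Set.sdiff_eq_empty.1 he) hYX]
      exact .refl
    obtain ⟨σ, hσ, hmax⟩ := Set.Finite.exists_maximalFor (value f) _ (Set.toFinite (X \ Y)) hne
    obtain ⟨α, β, hαβ, hσ'⟩ := exists_pair_of_not_isCritical (hc σ hσ)
    have hXα : α ∈ X := by
      rcases hσ' with rfl | rfl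
      exacts [hσ.1, (hXp _ _ hαβ).2 hσ.1]
    have hYα : α ∉ Y := by
      rcases hσ' with rfl | rfl
      exacts [hσ.2, fun h => hσ.2 ((hYp _ _ hαβ).1 h)]
    have hXβ : β ∈ X := (hXp _ _ hαβ).1 hXα
    have hYβ : β ∉ Y := fun h => hYα ((hYp _ _ hαβ).2 h)
    have hv : value f σ = value f α := by
      rcases hσ' with rfl | rfl
      exacts [rfl, (hf.value_eq_of_mem_H hαβ).symm]
    -- Any other coface of `α` would lie outside `Y` and have strictly larger potential, against
    -- maximality. So `α` is a free face.
    have key : ∀ ρ ∈ X, α.1 ⊆ ρ.1 → ρ = α ∨ ρ = β := by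
      intro ρ hρ hαρ
      by_contra! h
      have hlt : value f α < value f ρ := hf.value_lt_of_ssubset
        (Finset.ssubset_iff_subset_ne.2 ⟨hαρ, fun h' => h.1 (Subtype.ext h'.symm)⟩)
        fun h' => h.2 (hf.eq_of_mem_H h' hαβ)
      have := hmax ⟨hρ, fun h' => hYα (hY _ h' _ hαρ)⟩ (hv ▸ hlt.le)
      exact absurd (hlt.trans_le (hv ▸ this)) (lt_irrefl _)
    have hsub : IsSubcomplex (X \ {α, β}) := by
      rintro ρ ⟨hρ, hρ'⟩ τ hτ
      refine ⟨hX _ hρ _ hτ, ?_⟩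
      rintro (rfl | rfl)
      exacts [hρ' (key ρ hρ hτ), hρ' (key ρ hρ (hαβ.1.1.trans hτ))]
    refine .head (b := X \ {α, β}) ⟨hX, α, hXα, β, hXβ, hαβ.1, ?_, rfl⟩
      (ih _ ?_ hsub ?_ ?_ ?_ rfl)
    · intro ρ hρ h
      exact (key ρ hρ h.1).resolve_left h.ne.symm
    · rw [← hn]
      refine Set.ncard_lt_ncard ⟨Set.sdiff_subset, fun h => (h hXα).2 (.inl rfl)⟩ (Set.toFinite X)
    · intro ρ hρ
      refine ⟨hYX hρ, ?_⟩
      rintro (rfl | rfl)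
      exacts [hYα hρ, hYβ hρ]
    · intro σ₁ β₁ h₁
      have e₁ : σ₁ = α ↔ β₁ = β := by
        constructor
        · rintro rfl
          exact hf.eq_of_mem_H h₁ hαβ
        · rintro rfl
          exact hf.eq_of_mem_T h₁ hαβ
      have e₂ : σ₁ ≠ β := by
        rintro rfl
        exact hf.not_mem_H_of_mem_T hαβ h₁
      have e₃ : β₁ ≠ α := by
        rintro rfl
        exact hf.not_mem_H_of_mem_T h₁ hαβ
      have := hXp _ _ h₁
      simp only [Set.mem_sdiff, Set.mem_insert_iff, Set.mem_singleton_iff]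
      tauto
    · exact fun ρ hρ => hc ρ ⟨hρ.1.1, hρ.2⟩

end Value

/-! ### The gradient flow and its monotonicity. -/

section Flow

variable {ι : Type*} {K : PreAbstractSimplicialComplex ι} {k : ℕ} {f : K → Fin k → ℝ}

theorem gradient_self_iff {σ : K} : Gradient f σ σ ↔ IsCritical f σ := by
  constructor
  · rintro ⟨h, ⟨h', -⟩ | h'⟩
    · exact ⟨h', h⟩
    · have : σ ∈ H f σ := h' ▸ rfl
      exact absurd rfl this.1.ne
  · exact fun h => ⟨h.2, .inl ⟨h.1, rfl⟩⟩

theorem IsMDM.gradient_iff (hf : IsMDM f) {σ β : K} (hne : β ≠ σ) :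
    Gradient f σ β ↔ β ∈ H f σ := by
  constructor
  · rintro ⟨-, ⟨-, h⟩ | h⟩
    exacts [absurd h hne, h ▸ rfl]
  · exact fun h => ⟨hf.T_eq_empty_of_mem_H h,
      .inr (Set.eq_singleton_iff_unique_mem.2 ⟨h, fun _ h' => hf.eq_of_mem_H h' h⟩)⟩

theorem IsMDM.mem_flow_iff (hf : IsMDM f) {σ τ : K} : τ ∈ flow (Gradient f) σ ↔
    (IsCritical f σ ∧ τ.1 ⊆ σ.1) ∨ (∃ α ∈ T f σ, τ.1 ⊂ σ.1 ∧ τ ≠ α) ∨ τ ∈ H f σ := by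
  have hEx : τ ∈ Ex {σ} ↔ τ.1 ⊂ σ.1 := by
    simp only [Ex, Cl, Set.mem_sdiff, Set.mem_ofPred_eq, Set.mem_singleton_iff, exists_eq_left,
      Finset.ssubset_iff_subset_ne]
    rw [Subtype.ext_iff]
  refine or_congr (and_congr gradient_self_iff (by simp [Cl])) (or_congr ?_ ?_)
  · refine exists_congr fun α => ?_
    rw [Set.mem_sdiff, hEx, Set.mem_singleton_iff]
    constructor
    · rintro ⟨h, h', h''⟩
      exact ⟨(hf.gradient_iff h.symm).1 h', h''⟩
    · rintro ⟨h, h'⟩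
      exact ⟨h.1.ne, (hf.gradient_iff h.1.ne.symm).2 h, h'⟩
  · constructor
    · rintro ⟨h, h'⟩
      exact (hf.gradient_iff h').1 h
    · intro h
      exact ⟨(hf.gradient_iff h.1.ne.symm).2 h, h.1.ne.symm⟩

/-- The value decreases along the flow, and is constant only at critical simplices and along
the gradient. -/
theorem IsMDM.value_of_mem_flow (hf : IsMDM f) {σ τ : K} (h : τ ∈ flow (Gradient f) σ) :
    value f τ < value f σ ∨ (value f τ = value f σ ∧ (τ ∈ H f σ ∨ τ = σ)) := by
  rcases hf.mem_flow_iff.1 h with ⟨hc, h⟩ | ⟨α, hα, h, hne⟩ | h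
  · by_cases he : τ = σ
    · exact .inr ⟨he ▸ rfl, .inr he⟩
    · refine .inl (hf.value_lt_of_ssubset
        (Finset.ssubset_iff_subset_ne.2 ⟨h, fun h' => he (Subtype.ext h')⟩) fun h' => ?_)
      have : τ ∈ T f σ := h'
      simp [hc.2] at this
  · exact .inl (hf.value_lt_of_ssubset h fun h' => hne (hf.eq_of_mem_T h' hα))
  · exact .inr ⟨(hf.value_eq_of_mem_H h).symm, .inl h⟩

theorem IsMDM.value_le_of_connects (hf : IsMDM f) {σ τ : K} (h : Connects f σ τ) :
    value f τ ≤ value f σ := by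
  have step : ∀ {σ τ : K}, τ ∈ flow (Gradient f) σ → value f τ ≤ value f σ := fun h =>
    (hf.value_of_mem_flow h).elim le_of_lt fun h => h.1.le
  induction h with
  | single h => exact step h
  | tail _ h ih => exact (step h).trans ih

theorem IsMDM.connects_self (hf : IsMDM f) {σ : K} (h : IsCritical f σ) : Connects f σ σ :=
  .single (hf.mem_flow_iff.2 (.inl ⟨h, subset_rfl⟩))

theorem IsMDM.eq_of_connects_of_connects (hf : IsMDM f) {σ ρ : K} (hσ : IsCritical f σ)
    (h : Connects f σ ρ) (h' : Connects f ρ σ) : ρ = σ := by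
  have hle := hf.value_le_of_connects h'
  -- Only the inequality is kept: unlike the return path, it passes to every intermediate simplex of
  -- the induction. Constant potential then forces staying at `σ`, which has no gradient arrow.
  clear h'
  induction h with
  | single h =>
    rcases hf.value_of_mem_flow h with h | ⟨-, h | h⟩
    · exact absurd (h.trans_le hle) (lt_irrefl _)
    · simp [hσ.1] at h
    · exact h
  | @tail ρ' ρ h₁ h₂ ih =>
    have hρ := hf.value_le_of_connects (.single h₂)
    have : ρ' = σ := ih (hle.trans hρ)
    subst this
    rcases hf.value_of_mem_flow h₂ with h | ⟨-, h | h⟩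
    · exact absurd (h.trans_le hle) (lt_irrefl _)
    · simp [hσ.1] at h
    · exact h

/-- A proper face of the target of the gradient, other than the source, is reached by the flow. -/
theorem IsMDM.mem_flow_of_ssubset (hf : IsMDM f) {α β τ : K} (h : β ∈ H f α) (hτ : τ.1 ⊂ β.1)
    (hne : τ ≠ α) : τ ∈ flow (Gradient f) β :=
  hf.mem_flow_iff.2 (.inr (.inl ⟨α, h, hτ, hne⟩))

theorem IsMDM.connects_of_mem_H (hf : IsMDM f) {α β : K} (h : β ∈ H f α) : Connects f α β :=
  .single (hf.mem_flow_iff.2 (.inr (.inr h)))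

/-- The flow out of the source of a gradient pair passes through the target. -/
theorem IsMDM.connects_of_mem_H_of_connects (hf : IsMDM f) {α β τ : K} (h : β ∈ H f α)
    (hτ : Connects f α τ) (hc : IsCritical f τ) : Connects f β τ := by
  have key : ∀ {ρ}, ρ ∈ flow (Gradient f) α → ρ = β := by
    intro ρ hρ
    rcases hf.mem_flow_iff.1 hρ with ⟨hc, -⟩ | ⟨α', hα', -⟩ | h'
    · simp [hc.1] at h
    · exact absurd h (hf.not_mem_H_of_mem_T hα')
    · exact hf.eq_of_mem_H h' h
  rcases Relation.TransGen.head'_iff.1 hτ with ⟨ρ, hρ, hρτ⟩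
  rw [key hρ] at hρτ
  rcases Relation.reflTransGen_iff_eq_or_transGen.1 hρτ with rfl | h'
  · exact hf.connects_self hc
  · exact h'

/-- A solution from a critical simplex to the target of a gradient pair also gives one to the
source. -/
theorem IsMDM.connects_source (hf : IsMDM f) {α β τ : K} (h : β ∈ H f α)
    (hτ : Connects f τ β) (hc : IsCritical f τ) : Connects f τ α := by
  have hαβ : α.1 ⊂ β.1 :=
    Finset.ssubset_iff_subset_ne.2 ⟨h.1.1, fun h' => h.1.ne (Subtype.ext h')⟩
  rcases Relation.TransGen.tail'_iff.1 hτ with ⟨ρ, hτρ, hρ⟩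
  -- The last step into `β` is either the arrow from `α`, or a descent from some `ρ` to its face
  -- `β`. In the second case `ρ` flows to the smaller face `α` as well.
  have key : ρ = α ∨ α ∈ flow (Gradient f) ρ := by
    rcases hf.mem_flow_iff.1 hρ with ⟨hc, h'⟩ | ⟨α', hα', h', -⟩ | h'
    · exact .inr (hf.mem_flow_iff.2 (.inl ⟨hc, hαβ.1.trans h'⟩))
    · refine .inr (hf.mem_flow_of_ssubset hα' (hαβ.trans h') ?_)
      rintro rfl
      rw [hf.eq_of_mem_H h hα'] at h'
      exact (ssubset_irrefl _ h').elim
    · exact .inl (hf.eq_of_mem_T h' h)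
  rcases key with rfl | hα
  · rcases Relation.reflTransGen_iff_eq_or_transGen.1 hτρ with rfl | h'
    · simp [hc.1] at h
    · exact h'
  · exact Relation.TransGen.tail'_iff.2 ⟨ρ, hτρ, hα⟩

end Flow

/-! ### The chain of subcomplexes between `K(a)` and `K(b)`. -/

section Chain

variable {ι : Type*} {K : PreAbstractSimplicialComplex ι} {k : ℕ} {f : K → Fin k → ℝ}
  {a b : Fin k → ℝ}

theorem IsMDM.mem_criticalIn_iff (hf : IsMDM f) {σ : K} : σ ∈ criticalIn f a b ↔
    IsCritical f σ ∧ σ ∈ sublevel f b \ sublevel f a := by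
  refine and_congr_right fun hc => ?_
  rw [Set.mem_sdiff, hf.mem_sublevel_iff, hf.mem_sublevel_iff, value_of_H_eq_empty hc.1]
  simp [Q, Pi.le_def]

theorem mem_morseSet_iff {I : Set K} {σ : K} :
    σ ∈ morseSet f I ↔ (∃ τ ∈ I, Connects f τ σ) ∧ ∃ τ ∈ I, Connects f σ τ := by
  simp only [morseSet, connectingSet, Set.mem_iUnion, Set.mem_ofPred_eq, exists_prop]
  constructor
  · rintro ⟨τ, h, τ', h', h₁, h₂⟩
    exact ⟨⟨τ', h', h₁⟩, τ, h, h₂⟩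
  · rintro ⟨⟨τ', h', h₁⟩, τ, h, h₂⟩
    exact ⟨τ, h, τ', h', h₁, h₂⟩

theorem IsMDM.sublevel_of_connects (hf : IsMDM f) {σ τ : K} {c : Fin k → ℝ} (h : Connects f σ τ)
    (hσ : σ ∈ sublevel f c) : τ ∈ sublevel f c :=
  hf.mem_sublevel_iff.2 ((hf.value_le_of_connects h).trans (hf.mem_sublevel_iff.1 hσ))

/-- The flow cannot leave `K(a)`, while `I` lies outside it, so simplices of `K(a)` satisfy the
condition defining `A` automatically. -/
theorem IsMDM.mem_sublevel_union_unconnected_iff (hf : IsMDM f) (hab : a ≤ b) {σ : K} :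
    σ ∈ sublevel f a ∪ unconnected f a b (criticalIn f a b) ↔
      σ ∈ sublevel f b ∧ ∀ τ ∈ criticalIn f a b, ¬ Connects f σ τ := by
  have hsub : σ ∈ sublevel f a → σ ∈ sublevel f b := fun h =>
    hf.mem_sublevel_iff.2 ((hf.mem_sublevel_iff.1 h).trans hab)
  constructor
  · rintro (h | h)
    · exact ⟨hsub h, fun τ hτ hc =>
        (hf.mem_criticalIn_iff.1 hτ).2.2 (hf.sublevel_of_connects hc h)⟩
    · exact ⟨h.1.1, h.2⟩
  · rintro ⟨h, h'⟩
    by_cases ha : σ ∈ sublevel f a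
    exacts [.inl ha, .inr ⟨⟨h, ha⟩, h'⟩]

theorem IsMDM.pairClosed_union_unconnected (hf : IsMDM f) (hab : a ≤ b) :
    PairClosed f (sublevel f a ∪ unconnected f a b (criticalIn f a b)) := by
  intro σ β h
  rw [hf.mem_sublevel_union_unconnected_iff hab, hf.mem_sublevel_union_unconnected_iff hab,
    hf.pairClosed_sublevel b σ β h]
  refine and_congr_right fun _ => forall₂_congr fun τ hτ => not_congr ⟨fun h' => ?_, fun h' => ?_⟩
  · exact hf.connects_of_mem_H_of_connects h h' hτ.1
  · exact (hf.connects_of_mem_H h).trans h'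

/-- Closure under flow and pairing suffices: a critical simplex flows to all its faces, a target to
all proper faces but its source, and the faces of a source are faces of its target. -/
theorem IsMDM.isSubcomplex_union_unconnected (hf : IsMDM f) (hab : a ≤ b) :
    IsSubcomplex (sublevel f a ∪ unconnected f a b (criticalIn f a b)) := by
  have hpair := hf.pairClosed_union_unconnected hab
  have hclosed : ∀ σ ∈ sublevel f a ∪ unconnected f a b (criticalIn f a b),
      ∀ τ ∈ flow (Gradient f) σ,
        τ ∈ sublevel f a ∪ unconnected f a b (criticalIn f a b) := by
    intro σ hσ τ hτ
    rw [hf.mem_sublevel_union_unconnected_iff hab] at hσ ⊢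
    exact ⟨hf.sublevel_of_connects (.single hτ) hσ.1, fun ρ hρ h => hσ.2 ρ hρ (.head hτ h)⟩
  have htarget : ∀ {α β τ : K}, β ∈ H f α →
      β ∈ sublevel f a ∪ unconnected f a b (criticalIn f a b) → τ.1 ⊆ β.1 →
        τ ∈ sublevel f a ∪ unconnected f a b (criticalIn f a b) := by
    intro α β τ h hβ hτ
    by_cases hτα : τ = α
    · rwa [hτα, hpair _ _ h]
    by_cases hτβ : τ = β
    · rwa [hτβ]
    exact hclosed _ hβ _ (hf.mem_flow_of_ssubset h
      (Finset.ssubset_iff_subset_ne.2 ⟨hτ, fun h' => hτβ (Subtype.ext h')⟩) hτα)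
  intro σ hσ τ hτ
  by_cases hc : IsCritical f σ
  · exact hclosed _ hσ _ (hf.mem_flow_iff.2 (.inl ⟨hc, hτ⟩))
  obtain ⟨α, β, h, rfl | rfl⟩ := exists_pair_of_not_isCritical hc
  · exact htarget h ((hpair _ _ h).1 hσ) (hτ.trans h.1.1)
  · exact htarget h hσ hτ

theorem IsMDM.pairClosed_morseSet (hf : IsMDM f) :
    PairClosed f (morseSet f (criticalIn f a b)) := by
  intro σ β h
  rw [mem_morseSet_iff, mem_morseSet_iff]
  refine and_congr (exists_congr fun τ => and_congr_right fun hτ => ⟨fun h' => ?_, fun h' => ?_⟩)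
    (exists_congr fun τ => and_congr_right fun hτ => ⟨fun h' => ?_, fun h' => ?_⟩)
  · exact h'.trans (hf.connects_of_mem_H h)
  · exact hf.connects_source h h' hτ.1
  · exact hf.connects_of_mem_H_of_connects h h' hτ.1
  · exact (hf.connects_of_mem_H h).trans h'

theorem IsMDM.morseSet_subset_sublevel (hf : IsMDM f) :
    morseSet f (criticalIn f a b) ⊆ sublevel f b := by
  intro σ hσ
  obtain ⟨⟨τ, hτ, h⟩, -⟩ := mem_morseSet_iff.1 hσ
  exact hf.sublevel_of_connects h (hf.mem_criticalIn_iff.1 hτ).2.1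

theorem IsMDM.disjoint_morseSet (hf : IsMDM f) (hab : a ≤ b) :
    Disjoint (sublevel f a ∪ unconnected f a b (criticalIn f a b))
      (morseSet f (criticalIn f a b)) := by
  rw [Set.disjoint_left]
  intro σ hσ hσ'
  obtain ⟨-, τ, hτ, h⟩ := mem_morseSet_iff.1 hσ'
  exact ((hf.mem_sublevel_union_unconnected_iff hab).1 hσ).2 τ hτ h

theorem IsMDM.union_morseSet_subset (hf : IsMDM f) (hab : a ≤ b) :
    sublevel f a ∪ unconnected f a b (criticalIn f a b) ∪ morseSet f (criticalIn f a b) ⊆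
      sublevel f b :=
  Set.union_subset (fun _ h => ((hf.mem_sublevel_union_unconnected_iff hab).1 h).1)
    hf.morseSet_subset_sublevel

/-- A flow step out of `M(I)` either can still reach `I`, hence stays in `M(I)`, or cannot, hence
lands in `K(a) ∪ A`. The faces are then handled as for `K(a) ∪ A`. -/
theorem IsMDM.isSubcomplex_union_morseSet (hf : IsMDM f) (hab : a ≤ b) :
    IsSubcomplex (sublevel f a ∪ unconnected f a b (criticalIn f a b) ∪
      morseSet f (criticalIn f a b)) := by
  have hpair := hf.pairClosed_morseSet (a := a) (b := b)
  have hclosed : ∀ σ ∈ morseSet f (criticalIn f a b), ∀ τ ∈ flow (Gradient f) σ,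
      τ ∈ sublevel f a ∪ unconnected f a b (criticalIn f a b) ∪
        morseSet f (criticalIn f a b) := by
    intro σ hσ τ hτ
    by_cases h : ∃ ρ ∈ criticalIn f a b, Connects f τ ρ
    · obtain ⟨⟨ρ', hρ', h'⟩, -⟩ := mem_morseSet_iff.1 hσ
      exact .inr (mem_morseSet_iff.2 ⟨⟨ρ', hρ', h'.tail hτ⟩, h⟩)
    · push Not at h
      exact .inl ((hf.mem_sublevel_union_unconnected_iff hab).2
        ⟨hf.sublevel_of_connects (.single hτ) (hf.morseSet_subset_sublevel hσ), h⟩)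
  have htarget : ∀ {α β τ : K}, β ∈ H f α → β ∈ morseSet f (criticalIn f a b) → τ.1 ⊆ β.1 →
      τ ∈ sublevel f a ∪ unconnected f a b (criticalIn f a b) ∪
        morseSet f (criticalIn f a b) := by
    intro α β τ h hβ hτ
    by_cases hτα : τ = α
    · exact .inr (by rwa [hτα, hpair _ _ h])
    by_cases hτβ : τ = β
    · exact .inr (by rwa [hτβ])
    exact hclosed _ hβ _ (hf.mem_flow_of_ssubset h
      (Finset.ssubset_iff_subset_ne.2 ⟨hτ, fun h' => hτβ (Subtype.ext h')⟩) hτα)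
  rintro σ (hσ | hσ) τ hτ
  · exact .inl (hf.isSubcomplex_union_unconnected hab _ hσ _ hτ)
  by_cases hc : IsCritical f σ
  · exact hclosed _ hσ _ (hf.mem_flow_iff.2 (.inl ⟨hc, hτ⟩))
  obtain ⟨α, β, h, rfl | rfl⟩ := exists_pair_of_not_isCritical hc
  · exact htarget h ((hpair _ _ h).1 hσ) (hτ.trans h.1.1)
  · exact htarget h hσ hτ

/-- A critical simplex in `A` would belong to `I` and be connected to itself, so all of `A` is
paired off. -/
theorem IsMDM.collapses_union_unconnected [Finite K] (hf : IsMDM f) (hab : a ≤ b) :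
    Collapses (sublevel f a ∪ unconnected f a b (criticalIn f a b)) (sublevel f a) := by
  refine hf.collapses (hf.isSubcomplex_union_unconnected hab) (isSubcomplex_sublevel a)
    Set.subset_union_left (hf.pairClosed_union_unconnected hab) (hf.pairClosed_sublevel a) ?_
  rintro σ ⟨hσ, hσ'⟩ hc
  rw [hf.mem_sublevel_union_unconnected_iff hab] at hσ
  exact hσ.2 σ (hf.mem_criticalIn_iff.2 ⟨hc, hσ.1, hσ'⟩) (hf.connects_self hc)

theorem IsMDM.collapses_sublevel [Finite K] (hf : IsMDM f) (hab : a ≤ b) :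
    Collapses (sublevel f b) (sublevel f a ∪ unconnected f a b (criticalIn f a b) ∪
      morseSet f (criticalIn f a b)) := by
  refine hf.collapses (isSubcomplex_sublevel b) (hf.isSubcomplex_union_morseSet hab)
    (hf.union_morseSet_subset hab) (hf.pairClosed_sublevel b)
    ((hf.pairClosed_union_unconnected hab).union hf.pairClosed_morseSet) ?_
  rintro σ ⟨hσ, hσ'⟩ hc
  have hI : σ ∈ criticalIn f a b :=
    hf.mem_criticalIn_iff.2 ⟨hc, hσ, fun h => hσ' (.inl (.inl h))⟩
  exact hσ' (.inr (mem_morseSet_iff.2 ⟨⟨σ, hI, hf.connects_self hc⟩, σ, hI, hf.connects_self hc⟩))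

theorem morseSet_empty : morseSet f (∅ : Set K) = ∅ := by
  simp [morseSet]

theorem IsMDM.morseSet_singleton (hf : IsMDM f) {σ : K} (hσ : IsCritical f σ) :
    morseSet f {σ} = {σ} := by
  ext ρ
  simp only [mem_morseSet_iff, Set.mem_singleton_iff, exists_eq_left]
  constructor
  · rintro ⟨h, h'⟩
    exact hf.eq_of_connects_of_connects hσ h h'
  · rintro rfl
    exact ⟨hf.connects_self hσ, hf.connects_self hσ⟩

end Chain

end MDM

namespace MDM

open unitInterval Topology

/-! ### Gluing maps, strong deformation retracts and adjunction spaces. -/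

section Gluing

/-- Two continuous maps, one given where `s` vanishes and the other over the image of a closed
embedding `i`, glue if these closed sets cover and the maps agree on the overlap. -/
theorem exists_glue {E X W Z : Type*} [TopologicalSpace E] [TopologicalSpace X]
    [TopologicalSpace W] [TopologicalSpace Z] {i : E → X} (hi : IsClosedEmbedding i)
    (ρ : C(W, X)) (s : C(W, I)) (hcov : ∀ w, s w = 0 ∨ ρ w ∈ Set.range i)
    (P : C(W, Z)) (q : C(E × W, Z)) (hpq : ∀ w e, i e = ρ w → s w = 0 → P w = q (e, w)) :
    ∃ F : C(W, Z), (∀ w, s w = 0 → F w = P w) ∧ ∀ w e, i e = ρ w → F w = q (e, w) := by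
  classical
  let F : W → Z := fun w => if h : ρ w ∈ Set.range i then q (h.choose, w) else P w
  have hF : ∀ w e, i e = ρ w → F w = q (e, w) := by
    intro w e he
    have h : ρ w ∈ Set.range i := ⟨e, he⟩
    have : h.choose = e := hi.injective (h.choose_spec.trans he.symm)
    simp only [F, dif_pos h, this]
  have hF' : ∀ w, s w = 0 → F w = P w := by
    intro w hw
    by_cases h : ρ w ∈ Set.range i
    · obtain ⟨e, he⟩ := h
      rw [hF w e he, hpq w e he hw]
    · simp only [F, dif_neg h]
  refine ⟨⟨F, ?_⟩, hF', hF⟩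
  have c₁ : IsClosed {w | s w = 0} := isClosed_eq s.continuous continuous_const
  have c₂ : IsClosed (ρ ⁻¹' Set.range i) := hi.isClosed_range.preimage ρ.continuous
  have h₁ : ContinuousOn F {w | s w = 0} := P.continuous.continuousOn.congr hF'
  have h₂ : ContinuousOn F (ρ ⁻¹' Set.range i) := by
    rw [continuousOn_iff_continuous_domRestrict]
    let g : ρ ⁻¹' Set.range i → E := fun w => hi.toHomeomorph.symm ⟨ρ w, w.2⟩
    have hg : Continuous g := hi.toHomeomorph.symm.continuous.comp
      ((ρ.continuous.comp continuous_subtype_val).subtype_mk _)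
    have hgi : ∀ w, i (g w) = ρ w := fun w =>
      congrArg Subtype.val (hi.toHomeomorph.apply_symm_apply ⟨ρ w, w.2⟩)
    have : (ρ ⁻¹' Set.range i).domRestrict F = fun w => q (g w, w) := by
      funext w
      exact hF _ _ (hgi w)
    rw [this]
    exact q.continuous.comp (hg.prodMk continuous_subtype_val)
  have huniv : {w | s w = 0} ∪ ρ ⁻¹' Set.range i = Set.univ :=
    Set.eq_univ_of_forall hcov
  rw [← continuousOn_univ, ← huniv]
  exact h₁.union_of_isClosed h₂ c₁ c₂

/-- A retraction `(x, t) ↦ (space (x, t), time (x, t))` of `X × [0,1]` onto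
`X × {0} ∪ E × [0,1]` that does not increase the time. -/
structure CylinderRetraction {E X : Type*} [TopologicalSpace X] (i : E → X) where
  space : C(X × I, X)
  time : C(X × I, I)
  space_zero : ∀ x, space (x, 0) = x
  space_base : ∀ e t, space (i e, t) = i e
  time_base : ∀ e t, time (i e, t) = t
  time_le : ∀ x t, time (x, t) ≤ t
  cover : ∀ p, time p = 0 ∨ space p ∈ Set.range i

/-- A strong deformation retract. -/
def IsStrongDeformationRetract {A Y : Type*} [TopologicalSpace A] [TopologicalSpace Y]
    (i : C(A, Y)) : Prop :=
  ∃ r : C(Y, A), r.comp i = .id A ∧ (ContinuousMap.id Y).HomotopicRel (i.comp r) (Set.range i)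

theorem IsStrongDeformationRetract.nonempty_homotopyEquiv {A Y : Type*} [TopologicalSpace A]
    [TopologicalSpace Y] {i : C(A, Y)} (h : IsStrongDeformationRetract i) : Nonempty (Y ≃ₕ A) := by
  obtain ⟨r, hr, h⟩ := h
  exact ⟨⟨r, i, h.homotopic.symm, hr ▸ .refl _⟩⟩

theorem IsStrongDeformationRetract.comp {A B Y : Type*} [TopologicalSpace A] [TopologicalSpace B]
    [TopologicalSpace Y] {j : C(A, B)} {i : C(B, Y)} (hi : IsStrongDeformationRetract i)
    (hj : IsStrongDeformationRetract j) : IsStrongDeformationRetract (i.comp j) := by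
  obtain ⟨r, hr, ⟨F⟩⟩ := hi
  obtain ⟨s, hs, ⟨G⟩⟩ := hj
  have hr' : ∀ b, r (i b) = b := fun b => DFunLike.congr_fun hr b
  have hs' : ∀ b, s (j b) = b := fun b => DFunLike.congr_fun hs b
  refine ⟨s.comp r, ContinuousMap.ext fun a => by simp [hr', hs'], ⟨?_⟩⟩
  let F' : (ContinuousMap.id Y).HomotopyRel (i.comp r) (Set.range (i.comp j)) :=
    { toHomotopy := F.toHomotopy
      prop' := fun t x hx => F.prop t x (by
        obtain ⟨a, rfl⟩ := hx
        exact ⟨j a, rfl⟩) }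
  let G' : (i.comp r).HomotopyRel ((i.comp j).comp (s.comp r)) (Set.range (i.comp j)) :=
    { toFun := fun p => i (G (p.1, r p.2))
      continuous_toFun := by fun_prop
      map_zero_left := fun y => by simp
      map_one_left := fun y => by simp
      prop' := fun t x hx => by
        obtain ⟨a, rfl⟩ := hx
        have := G.eq_fst t (x := j a) ⟨a, rfl⟩
        simpa [hr'] using congrArg i this }
  exact F'.trans G'

end Gluing

namespace Attach

variable {E X Y Z : Type*} [TopologicalSpace X] [TopologicalSpace Y] [TopologicalSpace Z] {i : E → X} {φ : E → Y}

variable (i φ) in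
/-- The map of the attached space into the adjunction space. -/
def inl : C(X, Attach i φ) where
  toFun x := Quot.mk _ (Sum.inl x)
  continuous_toFun := continuous_quot_mk.comp continuous_inl

variable (i φ) in
/-- The inclusion of the base into the adjunction space. -/
def inr : C(Y, Attach i φ) where
  toFun y := Quot.mk _ (Sum.inr y)
  continuous_toFun := continuous_quot_mk.comp continuous_inr

theorem inl_eq_inr (e : E) : inl i φ (i e) = inr i φ (φ e) := Quot.sound (.glue e)

/-- The universal property of the adjunction space. -/
def desc (g : C(X, Z)) (h : C(Y, Z)) (hgh : ∀ e, g (i e) = h (φ e)) : C(Attach i φ, Z) where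
  toFun := Quot.lift (Sum.elim g h) (by
    rintro _ _ ⟨e⟩
    exact hgh e)
  continuous_toFun := continuous_quot_lift _ (g.continuous.sumElim h.continuous)

@[simp] theorem desc_inl (g : C(X, Z)) (h : C(Y, Z)) (hgh : ∀ e, g (i e) = h (φ e)) (x : X) :
    desc g h hgh (inl i φ x) = g x := rfl

@[simp] theorem desc_inr (g : C(X, Z)) (h : C(Y, Z)) (hgh : ∀ e, g (i e) = h (φ e)) (y : Y) :
    desc g h hgh (inr i φ y) = h y := rfl

@[elab_as_elim]
theorem ind {p : Attach i φ → Prop} (hl : ∀ x, p (inl i φ x)) (hr : ∀ y, p (inr i φ y)) (z) :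
    p z := by
  rcases z with ⟨x | y⟩
  exacts [hl x, hr y]

/-- Compatible homotopies on the two pieces give a homotopy on the adjunction space. -/
theorem homotopic_of {u v : C(Attach i φ, Z)} (G : C(X × I, Z)) (h : C(Y × I, Z))
    (hgh : ∀ e t, G (i e, t) = h (φ e, t))
    (hG₀ : ∀ x, G (x, 0) = u (inl i φ x)) (hG₁ : ∀ x, G (x, 1) = v (inl i φ x))
    (h₀ : ∀ y, h (y, 0) = u (inr i φ y)) (h₁ : ∀ y, h (y, 1) = v (inr i φ y)) :
    u.Homotopic v := by
  -- Currying lets the universal property of the quotient apply directly, with no need to know that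
  -- its product with the interval is a quotient.
  let F : C(Attach i φ, C(I, Z)) := desc G.curry h.curry fun e =>
    ContinuousMap.ext fun t => hgh e t
  refine ⟨{ toContinuousMap := F.uncurry.comp ⟨Prod.swap, continuous_swap⟩
            map_zero_left := fun z => ?_
            map_one_left := fun z => ?_ }⟩
  · induction z using ind with
    | hl x => exact hG₀ x
    | hr y => exact h₀ y
  · induction z using ind with
    | hl x => exact hG₁ x
    | hr y => exact h₁ y

/-- Enlarging the base along a strong deformation retract does not change the homotopy type of
the adjunction space. -/
theorem homotopyEquiv_of_isStrongDeformationRetract {A : Type*} [TopologicalSpace E]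
    [TopologicalSpace A] {j : C(A, Y)} (hj : IsStrongDeformationRetract j) (i : C(E, X)) (φ : C(E, A)) :
    Nonempty (Attach i φ ≃ₕ Attach i (j.comp φ)) := by
  obtain ⟨r, hr, ⟨F⟩⟩ := hj
  have hr' : ∀ b, r (j b) = b := fun b => DFunLike.congr_fun hr b
  refine ⟨⟨desc (inl _ _) ((inr _ _).comp j) fun e => inl_eq_inr (φ := j.comp φ) e,
    desc (inl _ _) ((inr _ _).comp r) fun e => ?_, ?_, .symm ?_⟩⟩
  · simp only [ContinuousMap.comp_apply, hr']
    exact inl_eq_inr e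
  · convert ContinuousMap.Homotopic.refl _
    ext z
    induction z using ind with
    | hl x => rfl
    | hr y => simp [hr']
  -- The homotopy is stationary on `X`; it is compatible with the gluing because `F` fixes the range
  -- of `j`, which contains the attaching points.
  · refine homotopic_of ((inl _ _).comp .fst) ⟨fun p => inr _ _ (F (p.2, p.1)), by fun_prop⟩
      (fun e t => ?_) (fun _ => rfl) (fun _ => rfl) (fun y => ?_) (fun y => ?_)
    · change inl _ _ (i e) = inr _ _ (F (t, j (φ e)))
      rw [F.eq_fst t ⟨_, rfl⟩]
      exact inl_eq_inr (φ := j.comp φ) e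
    · simp
    · simp

end Attach

/-! ### Homotopy invariance in the attaching map. -/

section HomotopicAttaching

variable {E X Y : Type*} [TopologicalSpace E] [TopologicalSpace X] [TopologicalSpace Y]
  {i : E → X} {φ₀ φ₁ : C(E, Y)}

open Attach

/-- This is homotopy extension: the map `inl` on `X × {0}` and `F` on `E × [0,1]` are precomposed
with the retraction. -/
theorem CylinderRetraction.exists_extension (R : CylinderRetraction i) (hi : IsClosedEmbedding i)
    (F : φ₀.Homotopy φ₁) : ∃ G : C(X × I, Attach i φ₀),
      (∀ p, R.time p = 0 → G p = inl _ _ (R.space p)) ∧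
      ∀ p e, i e = R.space p → G p = inr _ _ (F (R.time p, e)) := by
  refine exists_glue hi R.space R.time R.cover ((inl _ _).comp R.space)
    ⟨fun q => inr _ _ (F (R.time q.2, q.1)), by fun_prop⟩ fun w e he hw => ?_
  change inl _ _ (R.space w) = inr _ _ (F (R.time w, e))
  rw [← he, hw, F.apply_zero]
  exact inl_eq_inr e

/-- The comparison of the spaces attached by homotopic maps. -/
theorem CylinderRetraction.exists_push (R : CylinderRetraction i) (hi : IsClosedEmbedding i)
    (F : φ₀.Homotopy φ₁) : ∃ u : C(Attach i φ₁, Attach i φ₀),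
      (∀ y, u (inr _ _ y) = inr _ _ y) ∧
      (∀ x, R.time (x, 1) = 0 → u (inl _ _ x) = inl _ _ (R.space (x, 1))) ∧
      ∀ x e, i e = R.space (x, 1) → u (inl _ _ x) = inr _ _ (F (R.time (x, 1), e)) := by
  obtain ⟨G, hG, hG'⟩ := R.exists_extension hi F
  refine ⟨desc ⟨fun x => G (x, 1), by fun_prop⟩ (inr _ _) fun e => ?_, fun y => rfl,
    fun x => hG (x, 1), fun x e he => hG' (x, 1) e he⟩
  refine (hG' (i e, 1) e (R.space_base e 1).symm).trans ?_
  rw [R.time_base, F.apply_one]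

/-- At time `t` the cylinder is retracted up to height `t` and `G` is then run for time `t`. On the
part pushed into `E` at height `s`, the homotopy `F` is evaluated at the truncated difference `t -
s`. -/
theorem CylinderRetraction.push_comp_push (R : CylinderRetraction i) (hi : IsClosedEmbedding i)
    (F : φ₀.Homotopy φ₁) {u : C(Attach i φ₁, Attach i φ₀)} {v : C(Attach i φ₀, Attach i φ₁)}
    (hu : ∀ y, u (inr _ _ y) = inr _ _ y)
    (hu₀ : ∀ x, R.time (x, 1) = 0 → u (inl _ _ x) = inl _ _ (R.space (x, 1)))
    (hu₁ : ∀ x e, i e = R.space (x, 1) → u (inl _ _ x) = inr _ _ (F (R.time (x, 1), e)))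
    (hv : ∀ y, v (inr _ _ y) = inr _ _ y)
    (hv₀ : ∀ x, R.time (x, 1) = 0 → v (inl _ _ x) = inl _ _ (R.space (x, 1)))
    (hv₁ : ∀ x e, i e = R.space (x, 1) → v (inl _ _ x) = inr _ _ (F.symm (R.time (x, 1), e))) :
    (u.comp v).Homotopic (.id _) := by
  obtain ⟨G, hG, hG'⟩ := R.exists_extension hi F
  have hGu : ∀ x, G (x, 1) = u (inl _ _ x) := fun x => by
    rcases R.cover (x, 1) with h | ⟨e, he⟩
    · rw [hG _ h, hu₀ _ h]
    · rw [hG' _ e he, hu₁ _ e he]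
  let d : I × I → I := fun p => Set.projIcc 0 1 zero_le_one (p.1 - p.2 : ℝ)
  have hd : Continuous d := continuous_projIcc.comp (by fun_prop)
  -- These three values are the matching conditions: agreement with `G` at height `0`, stationarity
  -- over the base at height `t`, and the reversed homotopy at time `1`.
  have hd₀ : ∀ t, d (t, 0) = t := fun t => by simp [d]
  have hdt : ∀ t, d (t, t) = 0 := fun t => by simp [d]
  have hd₁ : ∀ t, d (1, t) = σ t := fun t => by
    have : (1 - t : ℝ) = (σ t : I) := by simp
    simp only [d, Set.Icc.coe_one, this, Set.projIcc_val]
  obtain ⟨P, hP, hP'⟩ := exists_glue hi R.space R.time R.cover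
    (Z := Attach i φ₀) ⟨fun p => G (R.space p, p.2), by fun_prop⟩
    ⟨fun q => inr _ _ (F (d (q.2.2, R.time q.2), q.1)), by fun_prop⟩ (by
      rintro ⟨x, t⟩ e he hw
      change G (R.space (x, t), t) = inr _ _ (F (d (t, R.time (x, t)), e))
      rw [hw, hd₀, ← he, hG' _ e (R.space_base e t).symm, R.time_base])
  refine .symm (homotopic_of P ((inr _ _).comp .fst) (fun e t => ?_) (fun x => ?_) (fun x => ?_)
    (fun y => rfl) (fun y => ?_))
  · rw [hP' _ e (R.space_base e t).symm]
    change inr _ _ (F (d (t, R.time (i e, t)), e)) = inr _ _ (φ₀ e)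
    rw [R.time_base, hdt, F.apply_zero]
  · have h0 : R.time (x, 0) = 0 := le_antisymm (R.time_le x 0) bot_le
    rw [hP _ h0]
    change G (R.space (x, 0), 0) = inl _ _ x
    rw [R.space_zero, hG _ h0, R.space_zero]
  · rcases R.cover (x, 1) with h | ⟨e, he⟩
    · rw [hP _ h, ContinuousMap.comp_apply, hv₀ _ h, ← hGu]
      rfl
    · rw [hP' _ e he, ContinuousMap.comp_apply, hv₁ _ e he, hu]
      change inr _ _ (F (d (1, R.time (x, 1)), e)) = _
      rw [hd₁, F.symm_apply]
  · simp [hu, hv]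

/-- Homotopic attaching maps give homotopy equivalent adjunction spaces. -/
theorem CylinderRetraction.homotopyEquiv (R : CylinderRetraction i) (hi : IsClosedEmbedding i)
    (h : φ₀.Homotopic φ₁) : Nonempty (Attach i φ₀ ≃ₕ Attach i φ₁) := by
  obtain ⟨F⟩ := h
  obtain ⟨u, hu, hu₀, hu₁⟩ := R.exists_push hi F
  obtain ⟨v, hv, hv₀, hv₁⟩ := R.exists_push hi F.symm
  exact ⟨⟨v, u, R.push_comp_push hi F hu hu₀ hu₁ hv hv₀ hv₁,
    R.push_comp_push hi F.symm hv hv₀ hv₁ hu hu₀ (by rwa [F.symm_symm])⟩⟩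

end HomotopicAttaching

end MDM

namespace MDM

open Topology

/-! ### Polyhedra, and collapses as deformation retractions. -/

section Realization

variable {ι : Type*} {K : PreAbstractSimplicialComplex ι}

theorem nonneg_of_mem_realization {S : Set K} {x : ι → ℝ} (hx : x ∈ realization S) (v : ι) :
    0 ≤ x v := by
  obtain ⟨σ, -, h, h', -⟩ := hx
  by_cases hv : v ∈ σ.1
  exacts [(h v hv).le, (h' v hv).ge]

/-- A point with nonnegative coordinates summing to one that is supported in a simplex of `S`
belongs to the realization of `S'` as soon as its exact support does. -/
theorem mem_realization_of_support {S S' : Set K} (hS : IsSubcomplex S) {σ : K} (hσ : σ ∈ S)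
    {x : ι → ℝ} (h₀ : ∀ v, 0 ≤ x v) (hout : ∀ v ∉ σ.1, x v = 0) (hsum : ∑ v ∈ σ.1, x v = 1)
    (h : ∀ τ ∈ S, (∀ v, v ∈ τ.1 ↔ 0 < x v) → τ ∈ S') : x ∈ realization S' := by
  classical
  let t : Finset ι := σ.1.filter fun v => 0 < x v
  have ht : t ⊆ σ.1 := Finset.filter_subset _ _
  have hmem : ∀ v, v ∈ t ↔ 0 < x v := by
    intro v
    rw [Finset.mem_filter, and_iff_right_iff_imp]
    intro hv
    by_contra hvσ
    exact hv.ne' (hout v hvσ)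
  have hzero : ∀ v ∉ t, x v = 0 := fun v hv =>
    le_antisymm (not_lt.1 fun h' => hv ((hmem v).2 h')) (h₀ v)
  have hsum' : ∑ v ∈ t, x v = 1 := by
    rw [← hsum]
    exact Finset.sum_subset ht fun v _ hv => hzero v hv
  have hne : t.Nonempty := by
    rw [Finset.nonempty_iff_ne_empty]
    intro he
    simp [he] at hsum'
  let τ : K := ⟨t, face_mem ht hne⟩
  exact ⟨τ, h τ (hS σ hσ τ ht) hmem, fun v hv => (hmem v).1 hv, hzero, hsum'⟩

theorem mem_realization_inter {S S' : Set K} {x : ι → ℝ} (h : x ∈ realization S)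
    (h' : x ∈ realization S') : x ∈ realization (S ∩ S') := by
  obtain ⟨σ, hσ, h₁, h₂, h₃⟩ := h
  obtain ⟨σ', hσ', h₁', h₂', -⟩ := h'
  have : σ = σ' := by
    refine Subtype.ext (Finset.ext fun v => ⟨fun hv => ?_, fun hv => ?_⟩)
    · by_contra hv'
      exact (h₁ v hv).ne' (h₂' v hv')
    · by_contra hv'
      exact (h₁' v hv).ne' (h₂ v hv')
  exact ⟨σ, ⟨hσ, this ▸ hσ'⟩, h₁, h₂, h₃⟩

theorem isCompact_realization [Finite K] {S : Set K} (hS : IsSubcomplex S) :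
    IsCompact (realization S) := by
  have heq : realization S = ⋃ σ ∈ S, {x : ι → ℝ | (∀ v, 0 ≤ x v) ∧ (∀ v ∉ σ.1, x v = 0) ∧
      ∑ v ∈ σ.1, x v = 1} := by
    ext x
    simp only [Set.mem_iUnion, Set.mem_ofPred_eq, exists_prop]
    constructor
    · intro hx
      have h₀ := nonneg_of_mem_realization hx
      obtain ⟨σ, hσ, -, h, h'⟩ := hx
      exact ⟨σ, hσ, h₀, h, h'⟩
    · rintro ⟨σ, hσ, h₀, h, h'⟩
      exact mem_realization_of_support hS hσ h₀ h h' fun τ hτ _ => hτ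
  rw [heq]
  refine (Set.toFinite S).isCompact_biUnion fun σ _ => ?_
  refine (isCompact_univ_pi fun _ : ι => isCompact_Icc (a := (0 : ℝ)) (b := 1)).of_isClosed_subset
    ?_ ?_
  · simp only [Set.ofPred_and, Set.ofPred_forall]
    refine (isClosed_iInter fun v => isClosed_le continuous_const (continuous_apply v)).inter
      ((isClosed_iInter fun v => isClosed_iInter fun _ =>
        isClosed_eq (continuous_apply v) continuous_const).inter
        (isClosed_eq (by fun_prop) continuous_const))
  · rintro x ⟨h₀, h, h'⟩ v -
    refine ⟨h₀ v, ?_⟩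
    by_cases hv : v ∈ σ.1
    · rw [← h']
      exact Finset.single_le_sum (fun u _ => h₀ u) hv
    · rw [h v hv]
      exact zero_le_one

theorem isClosedEmbedding_incl [Finite K] {S S' : Set K} (hS : IsSubcomplex S) (h : S ⊆ S') :
    IsClosedEmbedding (incl h) := by
  have := isCompact_iff_compactSpace.1 (isCompact_realization hS)
  exact (incl h).continuous.isClosedEmbedding (Set.inclusion_injective (realization_mono h))

/-- The smallest barycentric coordinate of a point at the vertices of `σ`. -/
noncomputable def minCoord (σ : K) (x : ι → ℝ) : ℝ :=
  σ.1.inf' (face_nonempty σ) x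

theorem continuous_minCoord (σ : K) : Continuous (minCoord σ) :=
  Continuous.finset_inf'_apply _ fun v _ => continuous_apply v

theorem minCoord_le {σ : K} {x : ι → ℝ} {v : ι} (hv : v ∈ σ.1) : minCoord σ x ≤ x v :=
  Finset.inf'_le _ hv

theorem minCoord_nonneg {σ : K} {x : ι → ℝ} (h : ∀ v, 0 ≤ x v) : 0 ≤ minCoord σ x :=
  Finset.le_inf' _ _ fun v _ => h v

theorem minCoord_eq_zero {σ : K} {x : ι → ℝ} (h : ∀ v, 0 ≤ x v) {v : ι} (hv : v ∈ σ.1)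
    (hxv : x v = 0) : minCoord σ x = 0 :=
  le_antisymm (hxv ▸ minCoord_le hv) (minCoord_nonneg h)

/-- With `τ = σ ∪ {v}`, points are pushed towards `v`, taking the same amount from each vertex of
`σ`, until a coordinate on `σ` vanishes. The amount is `minCoord σ`, which is zero on the remaining
complex, so one formula is continuous everywhere. -/
theorem ElementaryCollapse.isStrongDeformationRetract {S S' : Set K}
    (h : ElementaryCollapse S S') (hS' : S' ⊆ S) : IsStrongDeformationRetract (incl hS') := by
  classical
  obtain ⟨hS, σ, hσ, τ, hτ, hστ, huniq, rfl⟩ := h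
  obtain ⟨v, hvσ, hv⟩ := (Finset.covBy_iff_card_sdiff_eq_one (s := τ.1) (t := σ.1)).2
    ⟨hστ.1, by rw [Finset.card_sdiff_of_subset hστ.1, hστ.2]; omega⟩ |>.exists_finset_insert
  have hfree : ∀ ρ ∈ S, σ.1 ⊆ ρ.1 → ρ.1 ⊆ τ.1 := by
    intro ρ hρ hσρ w hw
    by_cases hwσ : w ∈ σ.1
    · exact hστ.1 hwσ
    have hsub : insert w σ.1 ⊆ ρ.1 := Finset.insert_subset hw hσρ
    let β : K := ⟨insert w σ.1, face_mem hsub (Finset.insert_nonempty _ _)⟩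
    have : β = τ := huniq β (hS _ hρ _ hsub)
      ⟨Finset.subset_insert _ _, Finset.card_insert_of_notMem hwσ⟩
    rw [← this]
    exact Finset.mem_insert_self _ _
  -- The weight at `v` makes the coordinates of the direction sum to zero, so total mass is
  -- preserved.
  let d : ι → ℝ := fun u => if u ∈ σ.1 then -1 else if u = v then σ.1.card else 0
  let F : ℝ → (ι → ℝ) → ι → ℝ := fun t x u => x u + t * minCoord σ x * d u
  have hF : Continuous fun p : ℝ × (ι → ℝ) => F p.1 p.2 := by
    refine continuous_pi fun u => ?_
    have := continuous_minCoord σ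
    fun_prop
  have hfix : ∀ t x, minCoord σ x = 0 → F t x = x := fun t x h => by
    funext u
    simp [F, h]
  have hsumd : ∑ u ∈ τ.1, d u = 0 := by
    rw [← hv, Finset.sum_insert hvσ, Finset.sum_congr rfl fun u hu => if_pos hu]
    simp [d, hvσ]
  have hmem : ∀ (t : unitInterval) (x : ι → ℝ), x ∈ realization S → F t x ∈ realization S ∧
      (t = 1 → F t x ∈ realization (S \ {σ, τ})) := by
    intro t x hx
    have h₀ := nonneg_of_mem_realization hx
    obtain ⟨ρ, hρ, h₁, h₂, h₃⟩ := id hx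
    by_cases hσρ : σ.1 ⊆ ρ.1
    · have hρτ := hfree ρ hρ hσρ
      have hx₀ : ∀ u ∉ τ.1, x u = 0 := fun u hu => h₂ u fun h => hu (hρτ h)
      have hm := minCoord_nonneg (σ := σ) h₀
      have hF₀ : ∀ u, 0 ≤ F t x u := by
        intro u
        by_cases hu : u ∈ σ.1
        · have h' : t * minCoord σ x ≤ x u :=
            (mul_le_of_le_one_left hm t.2.2).trans (minCoord_le hu)
          simp only [F, d, if_pos hu]
          linarith
        · refine add_nonneg (h₀ u) (mul_nonneg (mul_nonneg t.2.1 hm) ?_)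
          simp only [d, if_neg hu]
          split_ifs <;> positivity
      have hFout : ∀ u ∉ τ.1, F t x u = 0 := by
        intro u hu
        rw [← hv, Finset.mem_insert, not_or] at hu
        have := hx₀ u (by rw [← hv, Finset.mem_insert, not_or]; exact hu)
        simp [F, d, hu.1, hu.2, this]
      have hFsum : ∑ u ∈ τ.1, F t x u = 1 := by
        simp only [F]
        rw [Finset.sum_add_distrib, ← Finset.mul_sum, hsumd, mul_zero, add_zero, ← h₃]
        exact (Finset.sum_subset hρτ fun u _ hu => h₂ u hu).symm
      refine ⟨mem_realization_of_support hS hτ hF₀ hFout hFsum fun _ h _ => h, ?_⟩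
      rintro rfl
      refine mem_realization_of_support hS hτ hF₀ hFout hFsum fun π hπ hsupp => ⟨hπ, ?_⟩
      -- The coordinate attaining the minimum is emptied at time `1`, which excludes both `σ` and
      -- `τ` as support.
      obtain ⟨u, hu, hmin⟩ := Finset.exists_mem_eq_inf' (face_nonempty σ) x
      have hFu : F (1 : unitInterval) x u = 0 := by
        have : minCoord σ x = x u := hmin
        simp [F, d, hu, this]
      have huπ : u ∉ π.1 := fun h => ((hsupp u).1 h).ne' hFu
      rintro (rfl | rfl)
      exacts [huπ hu, huπ (hστ.1 hu)]
    · obtain ⟨u, hu, huρ⟩ := Finset.not_subset.1 hσρ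
      rw [hfix _ _ (minCoord_eq_zero h₀ hu (h₂ u huρ))]
      refine ⟨hx, fun _ => ⟨ρ, ⟨hρ, ?_⟩, h₁, h₂, h₃⟩⟩
      rintro (rfl | rfl)
      exacts [hσρ subset_rfl, hσρ hστ.1]
  have hfix' : ∀ (t : unitInterval) (x : ι → ℝ), x ∈ realization (S \ {σ, τ}) → F t x = x := by
    intro t x hx
    have h₀ := nonneg_of_mem_realization hx
    obtain ⟨ρ, ⟨hρ, hρ'⟩, h₁, h₂, h₃⟩ := hx
    have hσρ : ¬ σ.1 ⊆ ρ.1 := by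
      intro h
      have hρτ := hfree ρ hρ h
      by_cases hvρ : v ∈ ρ.1
      · refine hρ' (.inr (Subtype.ext (hρτ.antisymm ?_)))
        rw [← hv]
        exact Finset.insert_subset hvρ h
      · refine hρ' (.inl (Subtype.ext (Finset.Subset.antisymm (fun u hu => ?_) h)))
        have := hρτ hu
        rw [← hv, Finset.mem_insert] at this
        exact this.resolve_left fun h' => hvρ (h' ▸ hu)
    obtain ⟨u, hu, huρ⟩ := Finset.not_subset.1 hσρ
    exact hfix _ _ (minCoord_eq_zero h₀ hu (h₂ u huρ))
  refine ⟨⟨fun x => ⟨F (1 : unitInterval) x.1, (hmem 1 x.1 x.2).2 rfl⟩,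
    (hF.comp (continuous_const.prodMk continuous_subtype_val)).subtype_mk _⟩, ?_, ⟨?_⟩⟩
  · ext1 x
    exact Subtype.ext (hfix' 1 x.1 x.2)
  · exact
      { toFun := fun p => ⟨F p.1 p.2.1, (hmem p.1 p.2.1 p.2.2).1⟩
        continuous_toFun := (hF.comp (by fun_prop : Continuous fun p : unitInterval × realization S =>
          ((p.1 : ℝ), p.2.1))).subtype_mk _
        map_zero_left := fun x => Subtype.ext (by funext u; simp [F])
        map_one_left := fun x => rfl
        prop' := by
          rintro t _ ⟨x, rfl⟩
          exact Subtype.ext (hfix' t x.1 x.2) }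

theorem Collapses.subset {S S' : Set K} (h : Collapses S S') : S' ⊆ S := by
  induction h with
  | refl => exact subset_rfl
  | tail _ h ih =>
    obtain ⟨-, σ, -, τ, -, -, -, rfl⟩ := h
    exact Set.sdiff_subset.trans ih

theorem Collapses.isStrongDeformationRetract {S S' : Set K} (h : Collapses S S') :
    IsStrongDeformationRetract (incl h.subset) := by
  induction h with
  | refl => exact ⟨.id _, rfl, .refl _⟩
  | tail h₁ h ih =>
    exact ih.comp (h.isStrongDeformationRetract (Collapses.subset (.single h)))

end Realization

/-! ### Retracting the cylinder of a pair of finite complexes. -/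

section Cylinder

variable {ι : Type*} {K : PreAbstractSimplicialComplex ι} [Finite K]

/-- The sum of the smallest coordinates over the simplices of a set; it vanishes on the points
whose support contains none of these simplices. -/
noncomputable def depth (N : Set K) (x : ι → ℝ) : ℝ :=
  ∑ ρ ∈ (Set.toFinite N).toFinset, minCoord ρ x

theorem continuous_depth (N : Set K) : Continuous (depth N) :=
  continuous_finsetSum _ fun ρ _ => continuous_minCoord ρ

theorem depth_nonneg {N : Set K} {x : ι → ℝ} (h : ∀ v, 0 ≤ x v) : 0 ≤ depth N x :=
  Finset.sum_nonneg fun _ _ => minCoord_nonneg h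

theorem minCoord_le_depth {N : Set K} {x : ι → ℝ} (h : ∀ v, 0 ≤ x v) {ρ : K} (hρ : ρ ∈ N) :
    minCoord ρ x ≤ depth N x :=
  Finset.single_le_sum (f := fun ρ => minCoord ρ x) (fun _ _ => minCoord_nonneg h)
    ((Set.toFinite N).mem_toFinset.2 hρ)

theorem depth_eq_zero {L L' : Set K} (hL' : IsSubcomplex L') {x : ι → ℝ}
    (hx : x ∈ realization L') : depth (L \ L') x = 0 := by
  have h₀ := nonneg_of_mem_realization hx
  obtain ⟨σ, hσ, -, h, -⟩ := hx
  refine Finset.sum_eq_zero fun ρ hρ => ?_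
  rw [Set.Finite.mem_toFinset] at hρ
  obtain ⟨u, hu, huσ⟩ := Finset.not_subset.1 fun h' => hρ.2 (hL' σ hσ ρ h')
  exact minCoord_eq_zero h₀ hu (h u huσ)

variable (K) in
theorem exists_vertices : ∃ V : Finset ι, ∀ σ : K, σ.1 ⊆ V := by
  classical
  have := Fintype.ofFinite K
  exact ⟨Finset.univ.biUnion fun σ : K => σ.1, fun σ =>
    Finset.subset_biUnion_of_mem (fun σ : K => σ.1) (Finset.mem_univ σ)⟩

/-- Cylinders over pairs of finite complexes retract: cut off the small barycentric coordinates. -/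
theorem nonempty_cylinderRetraction {L L' : Set K} (hL : IsSubcomplex L)
    (hL' : IsSubcomplex L') (h : L' ⊆ L) : Nonempty (CylinderRetraction (incl h)) := by
  obtain ⟨V, hV⟩ := exists_vertices K
  let c := depth (L \ L')
  have hc : Continuous c := continuous_depth _
  -- Cutting at most `ε` from each of the `V.card` coordinates leaves mass at least `ε`, so
  -- normalization is possible.
  let ε : ℝ := 1 / (V.card + 1)
  have hε : 0 < ε := by positivity
  -- If `ε * t ≤ c x`, the time drops to `0`. Otherwise the cut is `c x`, which is at least
  -- `minCoord ρ x` for every `ρ` in `L \ L'`, so the new support lies in `L'`.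
  let l : (ι → ℝ) × ℝ → ℝ := fun p => min (ε * p.2) (c p.1)
  let y : (ι → ℝ) × ℝ → ι → ℝ := fun p v => max (p.1 v - l p) 0
  let D : (ι → ℝ) × ℝ → ℝ := fun p => ∑ v ∈ V, y p v
  have hl : Continuous l := by fun_prop
  have hy : ∀ v, Continuous fun p => y p v := fun v => by fun_prop
  have hD : Continuous D := continuous_finsetSum _ fun v _ => hy v
  have hsumV : ∀ {x : ι → ℝ} {σ : K}, (∀ v ∉ σ.1, x v = 0) →
      ∑ v ∈ V, x v = ∑ v ∈ σ.1, x v := fun {x σ} hx =>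
    (Finset.sum_subset (hV σ) fun v _ hv => hx v hv).symm
  have hy₀ : ∀ p v, 0 ≤ y p v := fun p v => le_max_right _ _
  have hl₀ : ∀ x ∈ realization L, ∀ t : unitInterval, 0 ≤ l (x, t) := fun x hx t =>
    le_min (mul_nonneg hε.le t.2.1) (depth_nonneg (nonneg_of_mem_realization hx))
  have hDpos : ∀ x ∈ realization L, ∀ t : unitInterval, 0 < D (x, t) := by
    intro x hx t
    obtain ⟨σ, -, -, hx₂, hx₃⟩ := hx
    have h₁ : ∑ v ∈ V, (x v - l (x, t)) ≤ D (x, t) :=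
      Finset.sum_le_sum fun v _ => le_max_left _ _
    rw [Finset.sum_sub_distrib, hsumV hx₂, hx₃, Finset.sum_const, nsmul_eq_mul] at h₁
    have h₂ : l (x, t) ≤ ε := (min_le_left _ _).trans (mul_le_of_le_one_right hε.le t.2.2)
    have h₃ : (V.card : ℝ) * l (x, t) ≤ V.card * ε := by gcongr
    have h₄ : (V.card : ℝ) * ε + ε = 1 := by
      simp only [ε]
      field_simp
    linarith
  have hyout : ∀ x ∈ realization L, ∀ t : unitInterval, ∀ σ : K, (∀ v ∉ σ.1, x v = 0) →
      ∀ v ∉ σ.1, y (x, t) v = 0 := by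
    intro x hx t σ hσ v hv
    refine max_eq_right ?_
    have := hl₀ x hx t
    simp only [hσ v hv]
    linarith
  have key : ∀ (x : ι → ℝ), x ∈ realization L → ∀ (t : unitInterval) (S' : Set K),
      (∀ τ ∈ L, (∀ v ∈ τ.1, l (x, t) < x v) → τ ∈ S') →
        (fun v => y (x, t) v / D (x, t)) ∈ realization S' := by
    intro x hx t S' hS'
    have hpos := hDpos x hx t
    obtain ⟨σ, hσ, hx₁, hx₂, hx₃⟩ := id hx
    have hout := hyout x hx t σ hx₂
    refine mem_realization_of_support hL hσ (fun v => div_nonneg (hy₀ _ _) hpos.le)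
      (fun v hv => by rw [hout v hv, zero_div]) ?_ fun τ hτ hsupp => hS' τ hτ fun v hv => ?_
    · rw [← Finset.sum_div, ← hsumV hout]
      exact div_self hpos.ne'
    · by_contra hlt
      have : y (x, t) v = 0 := max_eq_right (by dsimp only; linarith)
      have h' := (hsupp v).1 hv
      rw [this, zero_div] at h'
      exact lt_irrefl _ h'
  have hfix : ∀ x ∈ realization L, ∀ t : unitInterval, l (x, t) = 0 →
      (fun v => y (x, t) v / D (x, t)) = x := by
    intro x hx t hlt
    have h₁ : y (x, t) = x := by
      funext v
      simp only [y, hlt, sub_zero]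
      exact max_eq_left (nonneg_of_mem_realization hx v)
    have h₂ : D (x, t) = 1 := by
      obtain ⟨σ, -, -, hx₂, hx₃⟩ := hx
      simp only [D, h₁]
      rw [hsumV hx₂, hx₃]
    simp [h₁, h₂]
  have hcoe : Continuous fun p : realization L × unitInterval => (p.1.1, (p.2 : ℝ)) := by fun_prop
  refine ⟨{
    space := ⟨fun p => ⟨fun v => y (p.1, p.2) v / D (p.1, p.2),
      key p.1 p.1.2 p.2 L fun _ h _ => h⟩, ?_⟩
    time := ⟨fun p => ⟨max 0 (p.2 - c p.1 / ε), le_max_left _ _, max_le zero_le_one ?_⟩, ?_⟩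
    space_zero := fun x => Subtype.ext (hfix x x.2 0 ?_)
    space_base := fun x t => Subtype.ext (hfix x (realization_mono h x.2) t ?_)
    time_base := fun x t => Subtype.ext ?_
    time_le := fun x t => max_le t.2.1 ?_
    cover := fun p => ?_ }⟩
  · refine Continuous.subtype_mk (continuous_pi fun v => ?_) _
    exact ((hy v).comp hcoe).div (hD.comp hcoe) fun p => (hDpos p.1 p.1.2 p.2).ne'
  · have := div_nonneg (depth_nonneg (N := L \ L') (nonneg_of_mem_realization p.1.2)) hε.le
    exact (sub_le_self _ this).trans p.2.2.2
  · exact Continuous.subtype_mk (by fun_prop) _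
  · have := depth_nonneg (N := L \ L') (nonneg_of_mem_realization x.2)
    simp only [l, Set.Icc.coe_zero, mul_zero]
    exact min_eq_left this
  · simp only [l, c, depth_eq_zero hL' x.2]
    exact min_eq_right (mul_nonneg hε.le t.2.1)
  · change max 0 ((t : ℝ) - c x.1 / ε) = t
    simp only [c, depth_eq_zero hL' x.2, zero_div, sub_zero]
    exact max_eq_right t.2.1
  · exact sub_le_self _
      (div_nonneg (depth_nonneg (N := L \ L') (nonneg_of_mem_realization x.2)) hε.le)
  · rcases le_or_gt (p.2 : ℝ) (c p.1 / ε) with hp | hp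
    · exact .inl (Subtype.ext (max_eq_left (sub_nonpos.2 hp)))
    · refine .inr ⟨⟨_, key p.1 p.1.2 p.2 L' fun τ hτ hlt => ?_⟩, rfl⟩
      by_contra hτ'
      rw [div_lt_iff₀ hε, mul_comm] at hp
      have hlc : l (p.1, p.2) = c p.1 := min_eq_right hp.le
      rw [hlc] at hlt
      have h₁ : c p.1 < minCoord τ p.1 := (Finset.lt_inf'_iff _).2 hlt
      exact absurd (minCoord_le_depth (N := L \ L') (nonneg_of_mem_realization p.1.2) ⟨hτ, hτ'⟩)
        (not_le.2 h₁)

end Cylinder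

/-! ### Polyhedra as adjunction spaces. -/

section Adjunction

variable {ι : Type*} {K : PreAbstractSimplicialComplex ι}

theorem isSubcomplex_cl (S : Set K) : IsSubcomplex (Cl S) :=
  fun _ ⟨ρ, hρ, h⟩ _ hτ => ⟨ρ, hρ, hτ.trans h⟩

theorem subset_cl (S : Set K) : S ⊆ Cl S := fun σ hσ => ⟨σ, hσ, subset_rfl⟩

theorem cl_subset {S X : Set K} (hX : IsSubcomplex X) (h : S ⊆ X) : Cl S ⊆ X :=
  fun σ ⟨ρ, hρ, hσ⟩ => hX ρ (h hρ) σ hσ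

/-- If `L` and `L ∪ M` are complexes, then the polyhedron of `L ∪ M` is obtained from that of `L`
by attaching `M` along its exit set. -/
theorem nonempty_attach_homeomorph [Finite K] {L M : Set K} (hL : IsSubcomplex L)
    (hLM : IsSubcomplex (L ∪ M)) (hdisj : Disjoint L M) (hEx : Ex M ⊆ L) :
    Nonempty (AttachAlongExit (incl hEx) ≃ₜ realization (L ∪ M)) := by
  have hCl : Cl M ⊆ L ∪ M := cl_subset hLM Set.subset_union_right
  have := isCompact_iff_compactSpace.1 (isCompact_realization hL)
  have := isCompact_iff_compactSpace.1 (isCompact_realization (isSubcomplex_cl M))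
  have : CompactSpace (AttachAlongExit (incl hEx)) :=
    inferInstanceAs (CompactSpace (Quot _))
  let F : C(AttachAlongExit (incl hEx), realization (L ∪ M)) :=
    Attach.desc (incl hCl) (incl Set.subset_union_left) fun _ => rfl
  -- Since `L` and `M` are disjoint, the two pieces meet only in `|Ex M|`, where they are glued. A
  -- continuous bijection from a compact space to a Hausdorff one is then enough.
  have hmixed : ∀ (x : realization (Cl M)) (y : realization L), x.1 = y.1 →
      Attach.inl (incl (ex_subset_cl M)) (incl hEx) x = Attach.inr _ _ y := by
    intro x y hxy
    have h : x.1 ∈ realization (Ex M) := by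
      refine realization_mono ?_ (mem_realization_inter x.2 (hxy ▸ y.2))
      exact fun σ hσ => ⟨hσ.1, Set.disjoint_left.1 hdisj hσ.2⟩
    have := Attach.inl_eq_inr (i := incl (ex_subset_cl M)) (φ := incl hEx) ⟨x.1, h⟩
    convert this using 2
    · rfl
    · exact Subtype.ext hxy.symm
  have hinj : Function.Injective F := by
    intro p q hpq
    replace hpq := congrArg Subtype.val hpq
    induction p using Attach.ind with
    | hl x =>
      induction q using Attach.ind with
      | hl x' => exact congrArg _ (Subtype.ext hpq)
      | hr y => exact hmixed x y hpq
    | hr y =>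
      induction q using Attach.ind with
      | hl x => exact (hmixed x y hpq.symm).symm
      | hr y' => exact congrArg _ (Subtype.ext hpq)
  have hsurj : Function.Surjective F := by
    rintro ⟨x, σ, hσ | hσ, hx⟩
    · exact ⟨Attach.inr _ _ ⟨x, σ, hσ, hx⟩, rfl⟩
    · exact ⟨Attach.inl _ _ ⟨x, σ, subset_cl M hσ, hx⟩, rfl⟩
  exact ⟨Continuous.homeoOfEquivCompactToT2 (f := Equiv.ofBijective F ⟨hinj, hsurj⟩) F.continuous⟩

/-- Attaching `M` to a strong deformation retract `L₀` of `L`, by a map homotopic in `L` to the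
inclusion of the exit set. -/
theorem nonempty_homotopyEquiv_attach [Finite K] {L₀ L M : Set K} (h₀ : L₀ ⊆ L)
    (hr : IsStrongDeformationRetract (incl h₀)) (hL : IsSubcomplex L)
    (hLM : IsSubcomplex (L ∪ M)) (hdisj : Disjoint L M) (hEx : Ex M ⊆ L)
    (φ : C(realization (Ex M), realization L₀))
    (hφ : ((incl h₀).comp φ).Homotopic (incl hEx)) :
    Nonempty (realization (L ∪ M) ≃ₕ AttachAlongExit φ) := by
  have hExs : IsSubcomplex (Ex M) := fun σ hσ τ hτ =>
    ⟨isSubcomplex_cl M σ hσ.1 τ hτ, Set.disjoint_left.1 hdisj (hL σ (hEx hσ) τ hτ)⟩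
  obtain ⟨e₁⟩ := nonempty_attach_homeomorph hL hLM hdisj hEx
  obtain ⟨R⟩ := nonempty_cylinderRetraction (isSubcomplex_cl M) hExs (ex_subset_cl M)
  obtain ⟨e₂⟩ := R.homotopyEquiv (isClosedEmbedding_incl hExs _) hφ.symm
  obtain ⟨e₃⟩ := Attach.homotopyEquiv_of_isStrongDeformationRetract hr
    (incl (ex_subset_cl M)) φ
  exact ⟨e₁.symm.toHomotopyEquiv.trans (e₂.trans e₃.symm)⟩

end Adjunction

end MDM

/-! ### The extended Morse theorem. -/

theorem mainTheorem1 {ι : Type*} (K : PreAbstractSimplicialComplex ι) [Finite K] {k : ℕ}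
    (f : K → Fin k → ℝ) (hf : MDM.IsMDM f) (a b : Fin k → ℝ) (hab : a < b)
    (I M A : Set K) (hI : I = MDM.criticalIn f a b) (hM : M = MDM.morseSet f I)
    (hA : A = MDM.unconnected f a b I) :
    -- the chain of subcomplexes, with its outer steps collapses
    MDM.IsSubcomplex (MDM.sublevel f a) ∧
    MDM.IsSubcomplex (MDM.sublevel f a ∪ A) ∧
    MDM.IsSubcomplex (MDM.sublevel f a ∪ A ∪ M) ∧
    MDM.sublevel f a ∪ A ∪ M ⊆ MDM.sublevel f b ∧
    Disjoint (MDM.sublevel f a ∪ A) M ∧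
    MDM.Collapses (MDM.sublevel f a ∪ A) (MDM.sublevel f a) ∧
    MDM.Collapses (MDM.sublevel f b) (MDM.sublevel f a ∪ A ∪ M) ∧
    -- the special cases `I = ∅` and `I = {σ}`
    (I = ∅ → MDM.Collapses (MDM.sublevel f b) (MDM.sublevel f a)) ∧
    (∀ σ, I = {σ} → M = {σ}) ∧
    -- the attaching map, unique up to homotopy, and the homotopy equivalence
    ∃ hEx : MDM.Ex M ⊆ MDM.sublevel f a ∪ A,
      (∃ φ : C(MDM.realization (MDM.Ex M), MDM.realization (MDM.sublevel f a)),
        ((MDM.incl Set.subset_union_left).comp φ).Homotopic (MDM.incl hEx)) ∧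
      (∀ φ φ' : C(MDM.realization (MDM.Ex M), MDM.realization (MDM.sublevel f a)),
        ((MDM.incl Set.subset_union_left).comp φ).Homotopic (MDM.incl hEx) →
        ((MDM.incl Set.subset_union_left).comp φ').Homotopic (MDM.incl hEx) →
        φ.Homotopic φ') ∧
      ∀ φ : C(MDM.realization (MDM.Ex M), MDM.realization (MDM.sublevel f a)),
        ((MDM.incl Set.subset_union_left).comp φ).Homotopic (MDM.incl hEx) →
        Nonempty (MDM.realization (MDM.sublevel f b) ≃ₕ MDM.AttachAlongExit φ) := by
  subst hI hM hA
  have h₁ := hf.isSubcomplex_union_unconnected hab.le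
  have h₂ := hf.isSubcomplex_union_morseSet hab.le
  have hdisj := hf.disjoint_morseSet hab.le
  have hc₁ := hf.collapses_union_unconnected hab.le
  have hc₂ := hf.collapses_sublevel hab.le
  have hr := hc₁.isStrongDeformationRetract
  have hEx : MDM.Ex (MDM.morseSet f (MDM.criticalIn f a b)) ⊆ _ := fun σ hσ =>
    (MDM.cl_subset h₂ Set.subset_union_right hσ.1).resolve_right hσ.2
  refine ⟨MDM.isSubcomplex_sublevel a, h₁, h₂, hf.union_morseSet_subset hab.le, hdisj, hc₁, hc₂,
    fun hI => ?_, fun σ hσ => ?_, hEx, ?_, fun φ φ' hφ hφ' => ?_, fun φ hφ => ?_⟩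
  · refine hc₂.trans ?_
    rwa [hI, MDM.morseSet_empty, Set.union_empty, ← hI]
  · rw [hσ]
    exact hf.morseSet_singleton (hσ.symm ▸ Set.mem_singleton σ :
      σ ∈ MDM.criticalIn f a b).1
  · obtain ⟨r, -, h⟩ := hr
    -- The attaching map is the exit set followed by the retraction of `|K(a) ∪ A|` onto `|K(a)|`.
    exact ⟨r.comp (MDM.incl hEx), h.homotopic.symm.comp (.refl _)⟩
  · obtain ⟨r, hri, -⟩ := hr
    -- Uniqueness holds because the inclusion of `|K(a)|` has `r` as a left inverse.
    have h : (r.comp ((MDM.incl Set.subset_union_left).comp φ)).Homotopic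
        (r.comp ((MDM.incl Set.subset_union_left).comp φ')) :=
      (ContinuousMap.Homotopic.refl r).comp (hφ.trans hφ'.symm)
    rwa [← ContinuousMap.comp_assoc, ← ContinuousMap.comp_assoc, hri, ContinuousMap.id_comp,
      ContinuousMap.id_comp] at h
  · obtain ⟨e₁⟩ := hc₂.isStrongDeformationRetract.nonempty_homotopyEquiv
    obtain ⟨e₂⟩ := MDM.nonempty_homotopyEquiv_attach _ hr h₁ h₂ hdisj hEx φ hφ
    exact ⟨e₁.trans e₂⟩
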